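/- Let $n,N\ge 1$ and let $A=\{v_1,\dots,v_r\}\subseteq\mathbb R^{n-1}$ be a set of $r$ distinct points whose affine span is $\mathbb R^{n-1}$; put $P=\mathrm{conv}(A)$. Identify $v\in\mathbb R^{n-1}$ with $(1,v)\in\mathbb R^n$, and for $Q\subseteq\mathbb R^{n-1}$ let $K(Q)\subseteq\mathbb R^n$ be the cone generated by $Q$. Order $\mathbb R^N$ lexicographically, the top entry being the most significant. For $\Psi\in M_{N,r}(\mathbb R)$ let $\Psi(v_\ell)\in\mathbb R^N$ be its $\ell$-th column. *Subdivisions.* A marked polytope is a pair $(Q,A_Q)$ with $Q=\mathrm{conv}(A_Q)$, $A_Q$ finite. A polytopal subdivision of a full-dimensional marked polytope $(P',A')$ with $A'\subseteq A$ is a finite set $\mathcal Q$ of marked polytopes $(Q,A_Q)$ with $A_Q\subseteq A'$, $Q$ of dimension $n-1$, $\bigcup_{\mathcal Q} Q=P'$, such that for distinct members $(Q_1,A_1),(Q_2,A_2)$ the set $Q_1\cap Q_2$ is empty or a face of both and $A_1\cap Q_1\cap Q_2=A_2\cap Q_1\cap Q_2$. For subdivisions $\mathcal Q,\mathcal Q'$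 of $(P,A)$, $\mathcal Q$ refines $\mathcal Q'$ if for each $(Q',A_{Q'})\in\mathcal Q'$ the members of $\mathcal Q$ with $Q\subseteq Q'$ form a polytopal subdivision of $(Q',A_{Q'})$. Put $A_{\mathcal Q}=\bigcup_{Q\in\mathcal Q}A_Q$. *Closed GKZ-cones.* $\overline{C(\mathcal Q,N)}\subseteq M_{N,r}(\mathbb R)$ is the set of $\Psi$ for which there is a map $g:K(P)\to\mathbb R^N$ that is linear on each $K(Q)$, $Q\in\mathcal Q$, is continuous and convex upward, i.e. $g(tx+(1-t)y)\ge tg(x)+(1-t)g(y)$ for $x,y\in K(P)$, $t\in[0,1]$, and satisfies $g(v)=\Psi(v)$ for $v\in A_{\mathcal Q}$ and $g(v)\ge\Psi(v)$ for $v\in A\setminus A_{\mathcal Q}$. *Condition-cones and regularity.* For $\Delta\subseteq A$ that is a basis of $\mathbb R^n$ and $v\in A$ with $v=\sum_{w\in\Delta}a_w w$ in $\mathbb R^n$, put $u_{v,\Delta}=e_v-\sum_{w\in\Delta}a_we_w\in\mathbb R^A\cong\mathbb R^r$. The GKZ-condition-cone $\mathcal C_{\mathcal Q}\subseteq\mathbb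 R^r$ is generated by all $u_{v,\Delta}$ with $Q\in\mathcal Q$, $\Delta\subseteq A_Q$ a basis of $\mathbb R^n$, $v\in A$, together with all $-u_{v,\Delta}$ for which moreover $v\in A_Q$. $\mathcal Q$ is regular if $\mathcal C_{\mathcal Q}\subsetneq\mathcal C_{\mathcal Q'}$ for every subdivision $\mathcal Q'\ne\mathcal Q$ of $(P,A)$ that $\mathcal Q$ refines. *Polars, fans, co-fans.* For a cone $\mathcal C\subseteq\mathbb R^r$ let $P(\mathcal C)=\{\Psi\in M_{N,r}(\mathbb R):\Psi u\le 0\ \forall u\in\mathcal C\}$, and for a cone $C\subseteq M_{N,r}(\mathbb R)$ let $\mathcal P(C)=\{u\in\mathbb R^r:\Psi u\le 0\ \forall\Psi\in C\}$. A $\mu$-polyhedral cone is a finite intersection of sets $\{\Psi:\Psi u\le0\}$, $u\in\mathbb R^r$; its faces are the sets $C\cap\{\Psi:\Psi u=0\}$ with $u\in\mathcal P(C)$. A fan is a finite collection of $\mu$-polyhedral cones that is closed under taking faces and in which the intersection of any two members is a face of both; it is complete if its union is $M_{N,r}(\mathbb R)$. A co-face of a polyhedral cone $\mathcal C\subseteq\mathbb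 R^r$ is a set $\mathcal C+\mathbb R u$ with $u\in\mathcal C$. A co-fan is a finite collection of polyhedral cones in $\mathbb R^r$ that is closed under taking co-faces and in which the sum of any two members is a co-face of both. **Theorem.** Let $\mathbf\Sigma_N$ be the collection of the cones $\overline{C(\mathcal Q,N)}$ and $\mathfrak S$ the collection of the cones $\mathcal C_{\mathcal Q}$, where $\mathcal Q$ runs over all regular polytopal subdivisions of $(P,A)$. Then: 1. $\mathbf\Sigma_N$ is a fan of $\mu$-polyhedral cones in $M_{N,r}(\mathbb R)$, $\mathfrak S$ is a co-fan in $\mathbb R^r$, and they are in polar correspondence: $\mathcal C\mapsto P(\mathcal C)$ and $C\mapsto\mathcal P(C)$ are mutually inverse bijections between $\mathfrak S$ and $\mathbf\Sigma_N$, with $\overline{C(\mathcal Q,N)}=P(\mathcal C_{\mathcal Q})$ and $\mathcal C_{\mathcal Q}=\mathcal P(\overline{C(\mathcal Q,N)})$ for every regular $\mathcal Q$. 2. The cones $\overline{C(\mathcal Q,N)}$ for different regular $\mathcal Q$ are different. 3. For regular $\mathcal Q$, the faces of $\overline{C(\mathcal Q,N)}$ are exactly the cones $\overline{C(\mathcal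 Q',N)}$ with $\mathcal Q'$ a regular polytopal subdivision such that $\mathcal Q$ refines $\mathcal Q'$. 4. The fan $\mathbf\Sigma_N$ is complete. -/

import Mathlib

open scoped Pointwise

namespace GKZ

/-! ### Cones in `ℝ^r` -/

/-- A polyhedral cone in `ℝ^r`: the set of nonnegative combinations of finitely many vectors. -/
def IsPolyhedralCone {r : ℕ} (C : Set (Fin r → ℝ)) : Prop :=
  ∃ s : Finset (Fin r → ℝ), C = (PointedCone.hull ℝ (s : Set (Fin r → ℝ)) : Set (Fin r → ℝ))

/-- `F` is a co-face of `C`, that is `F = C + ℝ u` for some `u ∈ C`. -/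
def IsCoface {r : ℕ} (F C : Set (Fin r → ℝ)) : Prop :=
  ∃ u ∈ C, F = {x | ∃ c ∈ C, ∃ t : ℝ, x = c + t • u}

/-- A co-fan: a finite collection of polyhedral cones, closed under co-faces, in which the sum of
any two members is a co-face of both. -/
structure IsCofan {r : ℕ} (S : Set (Set (Fin r → ℝ))) : Prop where
  finite : S.Finite
  polyhedral : ∀ C ∈ S, IsPolyhedralCone C
  coface_mem : ∀ C ∈ S, ∀ F, IsCoface F C → F ∈ S
  add_coface : ∀ C₁ ∈ S, ∀ C₂ ∈ S, IsCoface (C₁ + C₂) C₁ ∧ IsCoface (C₁ + C₂) C₂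

/-! ### Cones of matrices -/

/-- The lexicographic order on `ℝ^N`; the top coordinate (index `0`) is the most significant. -/
def LexLE {N : ℕ} (a b : Fin N → ℝ) : Prop := toLex a ≤ toLex b

/-- The closed half-space `H_u^≤ = {Ψ | Ψ u ≤ 0}`. -/
def halfSpace (N : ℕ) {r : ℕ} (u : Fin r → ℝ) : Set (Matrix (Fin N) (Fin r) ℝ) :=
  {Ψ | LexLE (Ψ.mulVec u) 0}

/-- The subspace `H_u^0 = {Ψ | Ψ u = 0}`. -/
def zeroSpace (N : ℕ) {r : ℕ} (u : Fin r → ℝ) : Set (Matrix (Fin N) (Fin r) ℝ) :=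
  {Ψ | Ψ.mulVec u = 0}

/-- A `μ`-polyhedral cone: a finite intersection of closed half-spaces. -/
def IsMuPolyhedralCone {N r : ℕ} (C : Set (Matrix (Fin N) (Fin r) ℝ)) : Prop :=
  ∃ s : Finset (Fin r → ℝ), C = ⋂ u ∈ s, halfSpace N u

/-- The `N`-polar cone `P(C)` of a cone in `ℝ^r`. -/
def polar (N : ℕ) {r : ℕ} (C : Set (Fin r → ℝ)) : Set (Matrix (Fin N) (Fin r) ℝ) :=
  {Ψ | ∀ u ∈ C, LexLE (Ψ.mulVec u) 0}

/-- The co-polar cone in `ℝ^r` of a cone of matrices. -/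
def copolar {N r : ℕ} (C : Set (Matrix (Fin N) (Fin r) ℝ)) : Set (Fin r → ℝ) :=
  {u | ∀ Ψ ∈ C, LexLE (Ψ.mulVec u) 0}

/-- `F` is a face of `C`, that is `F = C ∩ H_u^0` for some `u` in the co-polar cone of `C`. -/
def IsFace {N r : ℕ} (F C : Set (Matrix (Fin N) (Fin r) ℝ)) : Prop :=
  ∃ u ∈ copolar C, F = C ∩ zeroSpace N u

/-- A fan of `μ`-polyhedral cones: a finite collection, closed under faces, in which the
intersection of any two members is a face of both. -/
structure IsFan {N r : ℕ} (S : Set (Set (Matrix (Fin N) (Fin r) ℝ))) : Prop where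
  finite : S.Finite
  muPolyhedral : ∀ C ∈ S, IsMuPolyhedralCone C
  face_mem : ∀ C ∈ S, ∀ F, IsFace F C → F ∈ S
  inter_face : ∀ C₁ ∈ S, ∀ C₂ ∈ S, IsFace (C₁ ∩ C₂) C₁ ∧ IsFace (C₁ ∩ C₂) C₂

/-- A collection of cones of matrices is complete if it covers the whole matrix space. -/
def IsComplete {N r : ℕ} (S : Set (Set (Matrix (Fin N) (Fin r) ℝ))) : Prop :=
  ⋃₀ S = Set.univ

/-- A collection `T` of cones of matrices and a collection `S` of cones in `ℝ^r` are in polar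
correspondence: polar and co-polar are mutually inverse bijections between `S` and `T`. -/
def PolarCorrespondence {N r : ℕ} (T : Set (Set (Matrix (Fin N) (Fin r) ℝ)))
    (S : Set (Set (Fin r → ℝ))) : Prop :=
  Set.BijOn (polar N) S T ∧ Set.BijOn copolar T S ∧ Set.InvOn copolar (polar N) S T

/-! ### Marked polytopes and polytopal subdivisions

The point configuration is a family `v : Fin r → ℝ^d`, where `d = n - 1`. A set of indices
`B : Finset (Fin r)` stands for the marked polytope `(conv (v '' B), v '' B)`. -/

variable {d r : ℕ}

/-- The polytope spanned by the points with indices in `B`. -/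
def poly (v : Fin r → (Fin d → ℝ)) (B : Finset (Fin r)) : Set (Fin d → ℝ) :=
  convexHull ℝ (v '' (B : Set (Fin r)))

/-- The finite set `𝒬` of marked polytopes is a polytopal subdivision of the (full-dimensional)
marked polytope with marking `S`. -/
structure IsSubdivision (v : Fin r → (Fin d → ℝ)) (S : Finset (Fin r))
    (𝒬 : Finset (Finset (Fin r))) : Prop where
  /-- Markings are taken from the given one. -/
  subset : ∀ B ∈ 𝒬, B ⊆ S
  /-- The cells are full-dimensional. -/
  fullDim : ∀ B ∈ 𝒬, affineSpan ℝ (v '' (B : Set (Fin r))) = ⊤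
  /-- The cells cover the polytope. -/
  cover : ⋃ B ∈ 𝒬, poly v B = poly v S
  /-- Two cells meet in a common face (`IsExposed` holds for the empty set and for the polytope
  itself; every face of a polytope is exposed). -/
  face : ∀ B ∈ 𝒬, ∀ B' ∈ 𝒬, B ≠ B' →
    IsExposed ℝ (poly v B) (poly v B ∩ poly v B') ∧
    IsExposed ℝ (poly v B') (poly v B ∩ poly v B')
  /-- The markings of two cells agree on their intersection. -/
  marking : ∀ B ∈ 𝒬, ∀ B' ∈ 𝒬, B ≠ B' → ∀ i, v i ∈ poly v B ∩ poly v B' → (i ∈ B ↔ i ∈ B')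

/-- Polytopal subdivisions of `(P, A)`, where `A` is the whole configuration and `P = conv A`. -/
@[ext]
structure Subdivision (v : Fin r → (Fin d → ℝ)) where
  /-- The markings of the cells. -/
  cells : Finset (Finset (Fin r))
  isSubdivision : IsSubdivision v Finset.univ cells

variable {v : Fin r → (Fin d → ℝ)}

open Classical in
/-- `𝒬` refines `𝒬'`: for each cell of `𝒬'` the cells of `𝒬` contained in it form a polytopal
subdivision of this marked cell. -/
def Refines (𝒬 𝒬' : Subdivision v) : Prop :=
  ∀ B' ∈ 𝒬'.cells, IsSubdivision v B' (𝒬.cells.filter fun B => poly v B ⊆ poly v B')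

/-- The set `A_𝒬` of (indices of) all points that are markings of some cell. -/
def Subdivision.marked (𝒬 : Subdivision v) : Set (Fin r) :=
  {i | ∃ B ∈ 𝒬.cells, i ∈ B}

/-! ### Closed GKZ-cones -/

/-- The embedding `ℝ^(n-1) → ℝ^n`, `x ↦ (1, x)`. -/
def homog (x : Fin d → ℝ) : Fin (d + 1) → ℝ := Fin.cons 1 x

/-- The cone `K(Q)` in `ℝ^n` generated by a (convex) polytope `Q` in `ℝ^(n-1)`. -/
def coneOver (Q : Set (Fin d → ℝ)) : Set (Fin (d + 1) → ℝ) :=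
  {y | ∃ c : ℝ, 0 ≤ c ∧ ∃ x ∈ Q, y = c • homog x}

/-- The map `g` is linear on the cone over each cell of `𝒬`. -/
def IsPiecewiseLinear {N : ℕ} (𝒬 : Subdivision v)
    (g : (Fin (d + 1) → ℝ) → (Fin N → ℝ)) : Prop :=
  ∀ B ∈ 𝒬.cells, ∃ ψ : (Fin (d + 1) → ℝ) →ₗ[ℝ] (Fin N → ℝ), Set.EqOn g ψ (coneOver (poly v B))

/-- The map `g` is continuous (Euclidean topology) and convex upward on `K`, with respect to the
lexicographic order. -/
def ConvexUpwardOn {N : ℕ} (K : Set (Fin (d + 1) → ℝ))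
    (g : (Fin (d + 1) → ℝ) → (Fin N → ℝ)) : Prop :=
  ContinuousOn g K ∧
  ∀ x ∈ K, ∀ y ∈ K, ∀ t : ℝ, 0 ≤ t → t ≤ 1 →
    LexLE (t • g x + (1 - t) • g y) (g (t • x + (1 - t) • y))

/-- The closed GKZ-cone of `𝒬` in the space of `N × r` matrices. The values of `g` outside `K(P)`
are irrelevant. -/
def closedCone (𝒬 : Subdivision v) (N : ℕ) : Set (Matrix (Fin N) (Fin r) ℝ) :=
  {Ψ | ∃ g : (Fin (d + 1) → ℝ) → (Fin N → ℝ),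
    IsPiecewiseLinear 𝒬 g ∧
    ConvexUpwardOn (coneOver (poly v Finset.univ)) g ∧
    (∀ i ∈ 𝒬.marked, g (homog (v i)) = fun k => Ψ k i) ∧
    (∀ i ∉ 𝒬.marked, LexLE (fun k => Ψ k i) (g (homog (v i))))}

/-! ### GKZ-condition-cones and regularity -/

/-- The points with indices in `Δ`, embedded in `ℝ^n`, form a basis of `ℝ^n`. -/
def IsAffBasis (v : Fin r → (Fin d → ℝ)) (Δ : Finset (Fin r)) : Prop :=
  LinearIndependent ℝ (fun w : Δ => homog (v w)) ∧
  Submodule.span ℝ (Set.range fun w : Δ => homog (v w)) = ⊤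

/-- The vector `e_i - ∑_{w ∈ Δ} a_w e_w`. -/
def relVec (i : Fin r) (Δ : Finset (Fin r)) (a : Fin r → ℝ) : Fin r → ℝ :=
  Pi.single i 1 - ∑ w ∈ Δ, a w • Pi.single w 1

/-- Generators of the GKZ-condition-cone: for a cell `B` and an affine basis `Δ ⊆ B` the vector
`u_{i,Δ}`, where `v_i = ∑_{w ∈ Δ} a_w v_w` in `ℝ^n`, and also its negative if `i ∈ B`. -/
def condGens (𝒬 : Subdivision v) : Set (Fin r → ℝ) :=
  {u | ∃ B ∈ 𝒬.cells, ∃ Δ ⊆ B, IsAffBasis v Δ ∧ ∃ (i : Fin r) (a : Fin r → ℝ),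
    homog (v i) = ∑ w ∈ Δ, a w • homog (v w) ∧
    (u = relVec i Δ a ∨ (i ∈ B ∧ u = -relVec i Δ a))}

/-- The GKZ-condition-cone of `𝒬`. -/
def condCone (𝒬 : Subdivision v) : Set (Fin r → ℝ) :=
  (PointedCone.hull ℝ (condGens 𝒬) : Set (Fin r → ℝ))

/-- `𝒬` is regular: its condition cone is properly contained in that of every strictly coarser
subdivision. -/
def IsRegular (𝒬 : Subdivision v) : Prop :=
  ∀ 𝒬' : Subdivision v, Refines 𝒬 𝒬' → 𝒬' ≠ 𝒬 → condCone 𝒬 ⊂ condCone 𝒬'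

/-- The collection `Σ_N` of closed GKZ-cones over all regular subdivisions. -/
def gkzFan (v : Fin r → (Fin d → ℝ)) (N : ℕ) : Set (Set (Matrix (Fin N) (Fin r) ℝ)) :=
  {C | ∃ 𝒬 : Subdivision v, IsRegular 𝒬 ∧ C = closedCone 𝒬 N}

/-- The collection of GKZ-condition-cones over all regular subdivisions. -/
def gkzCofan (v : Fin r → (Fin d → ℝ)) : Set (Set (Fin r → ℝ)) :=
  {C | ∃ 𝒬 : Subdivision v, IsRegular 𝒬 ∧ C = condCone 𝒬}

end GKZ

/-!
The matrix space only enters through polarity. For a polyhedral cone `C` in `ℝ^r` the cones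
`polar N C` and `C` determine each other (`copolar_polar`, from Farkas' lemma
`mem_hull_of_forall_dual`, using the functionals `Ψ` concentrated in the top row), faces of
`polar N C` correspond to co-faces of `C` (`isFace_polar_iff`), and `polar N (C + D)` is
`polar N C ∩ polar N D`. Moreover the closed GKZ-cone of any subdivision is the polar of its
condition cone (`closedCone_eq_polar`): if the matrix `Ψ` is nonpositive on the condition cone,
every cell `B` carries a linear map `ℓ_B` which equals `Ψ` on `B` and lies above `Ψ` elsewhere, and
the lexicographic minimum of the `ℓ_B` is the required piecewise linear concave map. Thus everything
reduces to the condition cones.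

A height function, encoded as a functional `φ` on `ℝ^r`, induces a subdivision `𝒬_φ`
(`inducedSubdivision`), whose cells are the full-dimensional sets of points where an affine function
above all heights touches them. The cells cover the polytope because an affine function of this kind
that is minimal at a point `x` has `x` in the convex hull of its contact set
(`exists_mem_inducedCells`). The two facts behind the theorem are the following.

* `φ` is nonpositive on the condition cone of `𝒬` if and only if `𝒬` refines `𝒬_φ`
  (`refines_inducedSubdivision_iff`).
* In this case the condition cone of `𝒬_φ` is generated by that of `𝒬` together with `-u` for all
  `u` in it with `φ u = 0` (`neg_mem_condCone_induced`, `condCone_induced_subset`); in particular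
  it is a co-face.

Choosing `φ` in the relative interior of the polar of a finitely generated cone
(`exists_dual_strict`) shows that the regular subdivisions are exactly the `𝒬_φ`, that every
co-face of a condition cone and every sum of two condition cones is the condition cone of some
`𝒬_φ`, and, since refinement is antisymmetric, that the condition cones of regular subdivisions are
pairwise different. For completeness, finitely many lexicographic inequalities for a matrix `Ψ`
follow from inequalities for a single real functional `φ` (`exists_dual_lexMap_nonpos`), so `Ψ` lies
in the closed GKZ-cone of `𝒬_φ`.
-/

namespace GKZ

/-! ### Finitely generated cones -/

/-- Membership in the cone generated by a finite family. -/
theorem mem_hull_image_iff {ι E : Type*} [AddCommGroup E] [Module ℝ E] {s : Finset ι} {a : ι → E}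
    {x : E} : x ∈ PointedCone.hull ℝ (a '' (s : Set ι)) ↔
      ∃ t : ι → ℝ, (∀ i ∈ s, 0 ≤ t i) ∧ ∑ i ∈ s, t i • a i = x := by
  classical
  constructor
  · intro h
    induction h using Submodule.span_induction with
    | mem x hx =>
      obtain ⟨i, hi, rfl⟩ := hx
      have hi' : i ∈ s := hi
      refine ⟨Pi.single i 1, fun j _ => ?_, ?_⟩
      · by_cases h : j = i
        · subst h; simp
        · simp [h]
      · rw [Finset.sum_eq_single i] <;> simp +contextual [hi']
    | zero => exact ⟨0, by simp, by simp⟩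
    | add x y _ _ hx hy =>
      obtain ⟨t, ht, rfl⟩ := hx
      obtain ⟨t', ht', rfl⟩ := hy
      exact ⟨t + t', fun i hi => add_nonneg (ht i hi) (ht' i hi), by
        simp [add_smul, Finset.sum_add_distrib]⟩
    | smul c x _ hx =>
      obtain ⟨t, ht, rfl⟩ := hx
      exact ⟨fun i => (c : ℝ) * t i, fun i hi => mul_nonneg c.2 (ht i hi), by
        rw [Finset.smul_sum]
        exact Finset.sum_congr rfl fun i _ => mul_smul _ _ _⟩
  · rintro ⟨t, ht, rfl⟩
    exact Submodule.sum_mem _ fun i hi =>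
      PointedCone.smul_mem _ (ht i hi) (Submodule.subset_span ⟨i, hi, rfl⟩)

/-- **Farkas' lemma**, by elimination of one generator at a time: if `f` is a functional which is
nonpositive on all generators but `a i`, and positive at `b` and hence at `a i`, then the problem
projects along `a i` to the kernel of `f`. -/
theorem mem_hull_of_forall_dual {ι E : Type*} [AddCommGroup E] [Module ℝ E] (s : Finset ι)
    (a : ι → E) (b : E)
    (h : ∀ f : Module.Dual ℝ E, (∀ i ∈ s, f (a i) ≤ 0) → f b ≤ 0) :
    b ∈ PointedCone.hull ℝ (a '' (s : Set ι)) := by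
  classical
  induction s using Finset.induction generalizing a b with
  | empty =>
    have hb : b = 0 := by
      refine (Module.forall_dual_apply_eq_zero_iff ℝ b).1 fun f => le_antisymm (h f (by simp)) ?_
      have := h (-f) (by simp)
      simpa using this
    simp [hb]
  | insert i s hi ih =>
    by_cases hs : ∀ f : Module.Dual ℝ E, (∀ j ∈ s, f (a j) ≤ 0) → f b ≤ 0
    · exact Submodule.span_mono (Set.image_mono (by simp)) (ih a b hs)
    · push Not at hs
      obtain ⟨f, hf, hfb⟩ := hs
      have hfi : 0 < f (a i) := by
        by_contra! hle
        exact hfb.not_ge (h f (Finset.forall_mem_insert _ _ _ |>.2 ⟨hle, hf⟩))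
      set c := (f (a i))⁻¹ with hc
      have hc0 : 0 < c := inv_pos.2 hfi
      have key := ih (fun j => a j - (c * f (a j)) • a i) (b - (c * f b) • a i) fun g hg => by
        have := h (g - (c * g (a i)) • f) (Finset.forall_mem_insert _ _ _ |>.2 ⟨?_, ?_⟩)
        · simp at this ⊢; nlinarith
        · simp [hc]; field_simp; simp
        · intro j hj
          have := hg j hj
          simp at this ⊢; nlinarith
      obtain ⟨t, ht, htb⟩ := mem_hull_image_iff.1 key
      have hb : b = ∑ j ∈ s, t j • a j + (c * (f b - ∑ j ∈ s, t j * f (a j))) • a i := by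
        have : ∑ j ∈ s, t j • (a j - (c * f (a j)) • a i) =
            ∑ j ∈ s, t j • a j - (c * ∑ j ∈ s, t j * f (a j)) • a i := by
          simp only [smul_sub, Finset.sum_sub_distrib, Finset.mul_sum, Finset.sum_smul, smul_smul]
          congr 1
          exact Finset.sum_congr rfl fun j _ => by congr 1; ring
        rw [this] at htb
        rw [mul_sub, sub_smul]
        rw [sub_eq_sub_iff_add_eq_add] at htb
        rw [add_sub, eq_sub_iff_add_eq]
        exact htb.symm
      rw [hb]
      refine add_mem (Submodule.sum_mem _ fun j hj => PointedCone.smul_mem _ (ht j hj)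
        (Submodule.subset_span ⟨j, by simp [hj], rfl⟩)) (PointedCone.smul_mem _ ?_
        (Submodule.subset_span ⟨i, by simp, rfl⟩))
      refine mul_nonneg hc0.le (sub_nonneg.2 (le_trans ?_ hfb.le))
      exact Finset.sum_nonpos fun j hj => mul_nonpos_of_nonneg_of_nonpos (ht j hj) (hf j hj)

/-- A point outside a finitely generated cone is strictly separated from it by a functional. -/
theorem exists_dual_of_notMem_hull {E : Type*} [AddCommGroup E] [Module ℝ E] {s : Set E}
    (hs : s.Finite) {b : E} (hb : b ∉ PointedCone.hull ℝ s) :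
    ∃ f : Module.Dual ℝ E, (∀ x ∈ s, f x ≤ 0) ∧ 0 < f b := by
  by_contra! h
  refine hb ?_
  have := mem_hull_of_forall_dual hs.toFinset id b fun f hf => h f fun x hx => hf x (by simpa)
  simpa using this

theorem dual_nonpos_of_mem_hull {E F : Type*} [AddCommGroup E] [Module ℝ E] [AddCommGroup F]
    [LinearOrder F] [IsOrderedAddMonoid F] [Module ℝ F] [PosSMulMono ℝ F] {s : Set E}
    {f : E →ₗ[ℝ] F} (hf : ∀ x ∈ s, f x ≤ 0) {x : E} (hx : x ∈ PointedCone.hull ℝ s) : f x ≤ 0 := by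
  induction hx using Submodule.span_induction with
  | mem x hx => exact hf x hx
  | zero => simp
  | add x y _ _ hx hy => rw [map_add]; exact add_nonpos hx hy
  | smul c x _ hx =>
    have : f (c • x) = (c : ℝ) • f x := f.map_smul (c : ℝ) x
    rw [this]
    exact smul_nonpos_of_nonneg_of_nonpos c.2 hx

/-- The elements of a cone at which a supporting functional vanishes are combinations of the
generators at which it vanishes. -/
theorem neg_mem_of_mem_hull {E : Type*} [AddCommGroup E] [Module ℝ E] {s : Set E}
    {f : Module.Dual ℝ E} (hf : ∀ x ∈ s, f x ≤ 0) {D : PointedCone ℝ E}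
    (hD : ∀ x ∈ s, f x = 0 → -x ∈ D) {x : E} (hx : x ∈ PointedCone.hull ℝ s) (hx0 : f x = 0) :
    -x ∈ D := by
  induction hx using Submodule.span_induction with
  | mem x hx => exact hD x hx hx0
  | zero => simp
  | add x y hx' hy' hx hy =>
    have h1 := dual_nonpos_of_mem_hull hf hx'
    have h2 := dual_nonpos_of_mem_hull hf hy'
    rw [map_add] at hx0
    rw [neg_add]
    exact add_mem (hx (by linarith)) (hy (by linarith))
  | smul c x _ hx =>
    have h1 : f (c • x) = (c : ℝ) * f x := f.map_smul (c : ℝ) x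
    rw [h1, mul_eq_zero] at hx0
    rcases hx0 with h | h
    · have : c = 0 := Subtype.ext h
      simp [this]
    · rw [← smul_neg]
      exact Submodule.smul_mem _ _ (hx h)

/-- A finitely generated cone carries a functional that is nonpositive on it and vanishes only on
its lineality space: a point of the relative interior of the polar cone. -/
theorem exists_dual_strict {E : Type*} [AddCommGroup E] [Module ℝ E] {s : Set E} (hs : s.Finite) :
    ∃ f : Module.Dual ℝ E, (∀ x ∈ s, f x ≤ 0) ∧
      ∀ x ∈ PointedCone.hull ℝ s, f x = 0 → -x ∈ PointedCone.hull ℝ s := by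
  classical
  have h1 : ∀ g : E, ∃ f : Module.Dual ℝ E, (∀ x ∈ s, f x ≤ 0) ∧
      (g ∈ s → -g ∉ PointedCone.hull ℝ s → f g < 0) := by
    intro g
    by_cases hg : -g ∈ PointedCone.hull ℝ s
    · exact ⟨0, by simp, fun _ h => absurd hg h⟩
    · obtain ⟨f, hf, hfg⟩ := exists_dual_of_notMem_hull hs hg
      exact ⟨f, hf, fun _ _ => by simpa using hfg⟩
  choose f hf hfg using h1
  have hle : ∀ x ∈ s, (∑ g ∈ hs.toFinset, f g) x ≤ 0 := fun x hx => by
    rw [LinearMap.sum_apply]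
    exact Finset.sum_nonpos fun g _ => hf g x hx
  refine ⟨∑ g ∈ hs.toFinset, f g, hle, fun x hx hx0 =>
    neg_mem_of_mem_hull hle (fun g hg h0 => ?_) hx hx0⟩
  by_contra hneg
  rw [LinearMap.sum_apply] at h0
  refine (Finset.sum_neg' (fun g' _ => hf g' g hg) ⟨g, by simpa, hfg g hg hneg⟩).ne h0

/-! ### The lexicographic order on `ℝ^N` -/

instance lexPosSMulStrictMono {N : ℕ} : PosSMulStrictMono ℝ (Lex (Fin N → ℝ)) where
  smul_lt_smul_of_pos_left := by
    rintro c hc a b ⟨i, hi, hlt⟩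
    exact ⟨i, fun j hj => congrArg (c * ·) (hi j hj), mul_lt_mul_of_pos_left hlt hc⟩

/-- A matrix as a linear map into `ℝ^N` with its lexicographic order. -/
def lexMap {N r : ℕ} (Ψ : Matrix (Fin N) (Fin r) ℝ) : (Fin r → ℝ) →ₗ[ℝ] Lex (Fin N → ℝ) :=
  (toLexLinearEquiv ℝ (Fin N → ℝ)).toLinearMap ∘ₗ Ψ.mulVecLin

variable {d r N : ℕ}

theorem lexMap_nonpos_iff {Ψ : Matrix (Fin N) (Fin r) ℝ} {u : Fin r → ℝ} :
    lexMap Ψ u ≤ 0 ↔ LexLE (Ψ.mulVec u) 0 := Iff.rfl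

theorem lexMap_single (Ψ : Matrix (Fin N) (Fin r) ℝ) (i : Fin r) :
    lexMap Ψ (Pi.single i 1) = toLex fun k => Ψ k i := by
  simp [lexMap]
  rfl

/-- A real functional is realized, up to signs, by the matrix having it as its top row and zeros
below. -/
theorem exists_lexMap_nonpos_iff (hN : 1 ≤ N) (φ : Module.Dual ℝ (Fin r → ℝ)) :
    ∃ Ψ : Matrix (Fin N) (Fin r) ℝ, ∀ u, lexMap Ψ u ≤ 0 ↔ φ u ≤ 0 := by
  obtain ⟨n, rfl⟩ : ∃ n, N = n + 1 := ⟨N - 1, by omega⟩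
  refine ⟨LinearMap.toMatrix' (LinearMap.single ℝ (fun _ : Fin (n + 1) => ℝ) 0 ∘ₗ φ), fun u => ?_⟩
  have h : lexMap (LinearMap.toMatrix' (LinearMap.single ℝ (fun _ : Fin (n + 1) => ℝ) 0 ∘ₗ φ)) u =
      toLex (Pi.single (0 : Fin (n + 1)) (φ u)) := by
    change toLex (Matrix.mulVec _ u) = _
    rw [LinearMap.toMatrix'_mulVec]
    rfl
  rw [h]
  constructor
  · intro hle
    by_contra! hpos
    refine hle.not_gt ⟨0, by simp, ?_⟩
    change (0 : ℝ) < (Pi.single (0 : Fin (n + 1)) (φ u) : Fin (n + 1) → ℝ) 0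
    simpa using hpos
  · intro hle
    change toLex _ ≤ toLex (0 : Fin (n + 1) → ℝ)
    refine Pi.toLex_monotone fun i => ?_
    by_cases hi : i = 0
    · subst hi; simpa using hle
    · simp [hi]

/-- Finitely many comparisons in the lexicographic order are implied by those of a single real
functional: the lexicographically positive vectors form a convex set without the origin, so
finitely many of them can be strictly separated from the origin. -/
theorem exists_dual_lexMap_nonpos (Ψ : Matrix (Fin N) (Fin r) ℝ) {U : Set (Fin r → ℝ)}
    (hU : U.Finite) :
    ∃ φ : Module.Dual ℝ (Fin r → ℝ), ∀ u ∈ U, φ u ≤ 0 → lexMap Ψ u ≤ 0 := by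
  set X : Set (Fin N → ℝ) := Ψ.mulVec '' {u ∈ U | 0 < lexMap Ψ u} with hX
  have hpos : convexHull ℝ X ⊆ {x | 0 < toLex x} := by
    refine convexHull_min ?_ ?_
    · rintro _ ⟨u, hu, rfl⟩
      exact hu.2
    · intro x hx y hy a b ha hb hab
      change 0 < a • toLex x + b • toLex y
      rcases ha.eq_or_lt with rfl | ha
      · rw [zero_add] at hab
        subst hab
        simpa using hy
      · exact add_pos_of_pos_of_nonneg (smul_pos ha hx) (smul_nonneg hb hy.le)
  have hfin : X.Finite := (hU.subset (Set.sep_subset _ _)).image _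
  obtain ⟨f, a, b, hfa, hab, hfb⟩ := geometric_hahn_banach_compact_closed
    (convex_convexHull ℝ X) (hfin.isCompact_convexHull ℝ) (convex_singleton (0 : Fin N → ℝ))
    isClosed_singleton (by
      rw [Set.disjoint_singleton_right]
      exact fun h => lt_irrefl (0 : Lex (Fin N → ℝ)) (hpos h))
  have hb : b < 0 := by simpa using hfb 0 rfl
  refine ⟨-(f.toLinearMap ∘ₗ Ψ.mulVecLin), fun u hu hle => ?_⟩
  by_contra! hlt
  have := hfa _ (subset_convexHull ℝ X ⟨u, ⟨hu, hlt⟩, rfl⟩)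
  simp at hle
  linarith

/-! ### Polarity -/

theorem mem_polar_hull_iff {s : Set (Fin r → ℝ)} {Ψ : Matrix (Fin N) (Fin r) ℝ} :
    Ψ ∈ polar N (PointedCone.hull ℝ s : Set (Fin r → ℝ)) ↔ ∀ u ∈ s, lexMap Ψ u ≤ 0 :=
  ⟨fun h u hu => h u (Submodule.subset_span hu), fun h _ hu => dual_nonpos_of_mem_hull h hu⟩

theorem copolar_polar (hN : 1 ≤ N) {C : Set (Fin r → ℝ)} (hC : IsPolyhedralCone C) :
    copolar (polar N C) = C := by
  obtain ⟨s, rfl⟩ := hC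
  refine Set.Subset.antisymm (fun u hu => ?_) fun u hu Ψ hΨ => hΨ u hu
  by_contra hnot
  obtain ⟨φ, hφ, hpos⟩ := exists_dual_of_notMem_hull s.finite_toSet hnot
  obtain ⟨Ψ, hΨ⟩ := exists_lexMap_nonpos_iff hN φ
  refine hpos.not_ge ((hΨ u).1 (hu Ψ ?_))
  exact mem_polar_hull_iff.2 fun x hx => (hΨ x).2 (hφ x hx)

theorem isMuPolyhedralCone_polar {C : Set (Fin r → ℝ)} (hC : IsPolyhedralCone C) :
    IsMuPolyhedralCone (polar N C) := by
  obtain ⟨s, rfl⟩ := hC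
  refine ⟨s, Set.ext fun Ψ => ?_⟩
  rw [mem_polar_hull_iff]
  simp [halfSpace, lexMap_nonpos_iff]

theorem polar_add {C D : Set (Fin r → ℝ)} (hC : 0 ∈ C) (hD : 0 ∈ D) :
    polar N (C + D) = polar N C ∩ polar N D := by
  ext Ψ
  constructor
  · exact fun h => ⟨fun u hu => h u ⟨u, hu, 0, hD, add_zero u⟩,
      fun u hu => h u ⟨0, hC, u, hu, zero_add u⟩⟩
  · rintro ⟨h1, h2⟩ _ ⟨x, hx, y, hy, rfl⟩
    change lexMap Ψ (x + y) ≤ 0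
    rw [map_add]
    exact add_nonpos (h1 x hx) (h2 y hy)

/-- The polar of the co-face `C + ℝ u` is the face cut out by `u`. -/
theorem polar_inter_zeroSpace {C : Set (Fin r → ℝ)} (hC : 0 ∈ C) (u : Fin r → ℝ) :
    polar N C ∩ zeroSpace N u = polar N {x | ∃ c ∈ C, ∃ t : ℝ, x = c + t • u} := by
  ext Ψ
  constructor
  · rintro ⟨h1, h2⟩ _ ⟨c, hc, t, rfl⟩
    have h2' : lexMap Ψ u = 0 := h2
    change lexMap Ψ (c + t • u) ≤ 0
    rw [map_add, map_smul, h2', smul_zero, add_zero]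
    exact h1 c hc
  · refine fun h => ⟨fun c hc => h c ⟨c, hc, 0, by simp⟩, ?_⟩
    have h1 : lexMap Ψ u ≤ 0 := h u ⟨0, hC, 1, by simp⟩
    have h2 : lexMap Ψ (-u) ≤ 0 := h (-u) ⟨0, hC, -1, by simp⟩
    rw [map_neg, neg_nonpos] at h2
    have h3 : lexMap Ψ u = 0 := le_antisymm h1 h2
    exact h3

theorem isFace_polar_iff (hN : 1 ≤ N) {C : Set (Fin r → ℝ)} (hC : IsPolyhedralCone C)
    {F : Set (Matrix (Fin N) (Fin r) ℝ)} :
    IsFace F (polar N C) ↔ ∃ D, IsCoface D C ∧ F = polar N D := by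
  have h0 : 0 ∈ C := by
    obtain ⟨s, rfl⟩ := hC
    exact Submodule.zero_mem _
  rw [IsFace, copolar_polar hN hC]
  constructor
  · rintro ⟨u, hu, rfl⟩
    exact ⟨_, ⟨u, hu, rfl⟩, polar_inter_zeroSpace h0 u⟩
  · rintro ⟨_, ⟨u, hu, rfl⟩, rfl⟩
    exact ⟨u, hu, (polar_inter_zeroSpace h0 u).symm⟩

/-! ### Homogenization -/

theorem homog_combo {a b : ℝ} (hab : a + b = 1) (x y : Fin d → ℝ) :
    homog (a • x + b • y) = a • homog x + b • homog y := by
  ext i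
  refine Fin.cases ?_ (fun j => ?_) i
  · simp [homog, hab]
  · simp [homog]

theorem sum_smul_homog_eq_iff {ι : Type*} {s : Finset ι} {v : ι → Fin d → ℝ} {t : ι → ℝ}
    {c : ℝ} {x : Fin d → ℝ} :
    ∑ i ∈ s, t i • homog (v i) = c • homog x ↔ ∑ i ∈ s, t i = c ∧ ∑ i ∈ s, t i • v i = c • x := by
  rw [funext_iff, Fin.forall_fin_succ, funext_iff]
  simp [homog, Finset.sum_apply]

variable {v : Fin r → (Fin d → ℝ)}

theorem mem_poly_iff {B : Finset (Fin r)} {x : Fin d → ℝ} :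
    x ∈ poly v B ↔ ∃ t : Fin r → ℝ, (∀ i ∈ B, 0 ≤ t i) ∧ ∑ i ∈ B, t i = 1 ∧
      ∑ i ∈ B, t i • v i = x := by
  constructor
  · intro h
    have : convexHull ℝ (v '' (B : Set (Fin r))) ⊆ {x | ∃ t : Fin r → ℝ, (∀ i ∈ B, 0 ≤ t i) ∧
        ∑ i ∈ B, t i = 1 ∧ ∑ i ∈ B, t i • v i = x} := by
      refine convexHull_min ?_ ?_
      · rintro _ ⟨i, hi, rfl⟩
        have hi' : i ∈ B := hi
        refine ⟨Pi.single i 1, fun j _ => ?_, ?_, ?_⟩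
        · by_cases h : j = i
          · subst h; simp
          · simp [h]
        · rw [Finset.sum_eq_single i] <;> simp +contextual [hi']
        · rw [Finset.sum_eq_single i] <;> simp +contextual [hi']
      · rintro _ ⟨t, ht, ht1, rfl⟩ _ ⟨t', ht', ht1', rfl⟩ a b ha hb hab
        refine ⟨a • t + b • t', fun i hi => ?_, ?_, ?_⟩
        · exact add_nonneg (mul_nonneg ha (ht i hi)) (mul_nonneg hb (ht' i hi))
        · simp [Finset.sum_add_distrib, ← Finset.mul_sum, ht1, ht1', hab]
        · simp [Finset.sum_add_distrib, add_smul, Finset.smul_sum, mul_smul]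
    exact this h
  · rintro ⟨t, ht, ht1, rfl⟩
    exact (convex_convexHull ℝ _).sum_mem ht ht1 fun i hi => subset_convexHull ℝ _ ⟨i, hi, rfl⟩

theorem homog_mem_hull_iff {B : Finset (Fin r)} {x : Fin d → ℝ} :
    homog x ∈ PointedCone.hull ℝ ((fun i => homog (v i)) '' (B : Set (Fin r))) ↔ x ∈ poly v B := by
  rw [mem_hull_image_iff, mem_poly_iff]
  refine exists_congr fun t => and_congr_right fun _ => ?_
  have := sum_smul_homog_eq_iff (s := B) (v := v) (t := t) (c := 1) (x := x)
  rwa [one_smul, one_smul] at this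

theorem subset_poly {B : Finset (Fin r)} {i : Fin r} (hi : i ∈ B) : v i ∈ poly v B :=
  subset_convexHull ℝ _ ⟨i, hi, rfl⟩

theorem poly_mono {B B' : Finset (Fin r)} (h : B ⊆ B') : poly v B ⊆ poly v B' :=
  convexHull_mono (Set.image_mono (by simpa using h))

theorem isClosed_poly (B : Finset (Fin r)) : IsClosed (poly v B) :=
  ((B.finite_toSet.image v).isCompact_convexHull ℝ).isClosed

/-- The cone over a nonempty polytope is the cone generated by the homogenized points. -/
theorem coneOver_poly {B : Finset (Fin r)} (hB : B.Nonempty) :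
    coneOver (poly v B) =
      (PointedCone.hull ℝ ((fun i => homog (v i)) '' (B : Set (Fin r))) : Set _) := by
  ext y
  rw [SetLike.mem_coe]
  constructor
  · rintro ⟨c, hc, x, hx, rfl⟩
    exact PointedCone.smul_mem _ hc (homog_mem_hull_iff.2 hx)
  · rw [mem_hull_image_iff]
    rintro ⟨t, ht, rfl⟩
    rcases (Finset.sum_nonneg ht).eq_or_lt with h | h
    · obtain ⟨j, hj⟩ := hB
      refine ⟨0, le_rfl, v j, subset_poly hj, ?_⟩
      rw [zero_smul]
      refine Finset.sum_eq_zero fun i hi => ?_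
      rw [(Finset.sum_eq_zero_iff_of_nonneg ht).1 h.symm i hi, zero_smul]
    · refine ⟨∑ i ∈ B, t i, h.le, (∑ i ∈ B, t i)⁻¹ • ∑ i ∈ B, t i • v i, ?_, ?_⟩
      · rw [mem_poly_iff]
        refine ⟨fun i => (∑ i ∈ B, t i)⁻¹ * t i, fun i hi =>
          mul_nonneg (inv_nonneg.2 h.le) (ht i hi), ?_, ?_⟩
        · rw [← Finset.mul_sum, inv_mul_cancel₀ h.ne']
        · simp [Finset.smul_sum, mul_smul]
      · rw [sum_smul_homog_eq_iff]
        exact ⟨rfl, (smul_inv_smul₀ h.ne' _).symm⟩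

theorem isClosed_hull {n : ℕ} {s : Set (Fin n → ℝ)} (hs : s.Finite) :
    IsClosed (PointedCone.hull ℝ s : Set (Fin n → ℝ)) := by
  have : (PointedCone.hull ℝ s : Set (Fin n → ℝ)) =
      ⋂ f ∈ {f : Module.Dual ℝ (Fin n → ℝ) | ∀ x ∈ s, f x ≤ 0}, {x | f x ≤ 0} := by
    ext x
    simp only [Set.mem_ofPred_eq, Set.mem_iInter, SetLike.mem_coe]
    refine ⟨fun hx f hf => dual_nonpos_of_mem_hull hf hx, fun h => ?_⟩
    by_contra hx
    obtain ⟨f, hf, hpos⟩ := exists_dual_of_notMem_hull hs hx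
    exact hpos.not_ge (h f hf)
  rw [this]
  exact isClosed_biInter fun f _ =>
    isClosed_le (LinearMap.continuous_of_finiteDimensional f) continuous_const

theorem dual_eq_zero_of_affineSpan {s : Set (Fin d → ℝ)} (hs : affineSpan ℝ s = ⊤)
    {F : Type*} [AddCommGroup F] [Module ℝ F] {f : (Fin (d + 1) → ℝ) →ₗ[ℝ] F}
    (hf : ∀ x ∈ s, f (homog x) = 0) : f = 0 := by
  let H : (Fin d → ℝ) →ᵃ[ℝ] F :=
    { toFun := fun x => f (homog x)
      linear := f ∘ₗ (LinearMap.pi (Fin.cons 0 fun j => LinearMap.proj j))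
      map_vadd' := fun p x => by
        simp only [vadd_eq_add, LinearMap.comp_apply, ← map_add]
        congr 1
        ext i
        refine Fin.cases ?_ (fun j => ?_) i <;> simp [homog] }
  have h0 : H = AffineMap.const ℝ _ 0 := AffineMap.ext_on hs fun x hx => hf x hx
  have h1 : ∀ x, f (homog x) = 0 := fun x => DFunLike.congr_fun h0 x
  refine LinearMap.ext fun y => ?_
  have hy : y = homog (Fin.tail y) + (y 0 - 1) • homog 0 := by
    ext i
    refine Fin.cases ?_ (fun j => ?_) i <;> simp [homog, Fin.tail]
  rw [hy, map_add, map_smul, h1, h1]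
  simp

theorem affineSpan_eq_top_iff {B : Finset (Fin r)} :
    affineSpan ℝ (v '' (B : Set (Fin r))) = ⊤ ↔
      Submodule.span ℝ ((fun i => homog (v i)) '' (B : Set (Fin r))) = ⊤ := by
  constructor
  · intro h
    by_contra hne
    obtain ⟨f, hf, hle⟩ := Submodule.exists_le_ker_of_lt_top _ (lt_top_iff_ne_top.2 hne)
    refine hf (dual_eq_zero_of_affineSpan h ?_)
    rintro _ ⟨i, hi, rfl⟩
    exact hle (Submodule.subset_span ⟨i, hi, rfl⟩)
  · intro h
    refine eq_top_iff.2 fun x _ => ?_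
    have hx : homog x ∈ Submodule.span ℝ ((fun i => homog (v i)) '' (B : Set (Fin r))) := by
      rw [h]; trivial
    obtain ⟨c, hc⟩ := (Submodule.mem_span_image_finset_iff_exists_fun ℝ).1 hx
    have := (sum_smul_homog_eq_iff (s := Finset.univ) (v := fun i : B => v i) (t := c)
      (c := 1) (x := x)).1 (by simpa using hc)
    rw [one_smul] at this
    obtain ⟨h1, h2⟩ := this
    have := affineCombination_mem_affineSpan (s := Finset.univ) h1 (fun i : B => v i)
    rw [Finset.affineCombination_eq_linear_combination _ _ _ h1, h2] at this
    convert this using 2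
    ext y
    simp

/-! ### Affine bases and linear relations -/

theorem IsAffBasis.exists_linear {F : Type*} [AddCommGroup F] [Module ℝ F] {Δ : Finset (Fin r)}
    (hΔ : IsAffBasis v Δ) (p : Fin r → F) :
    ∃ ℓ : (Fin (d + 1) → ℝ) →ₗ[ℝ] F, ∀ w ∈ Δ, ℓ (homog (v w)) = p w := by
  let b := Module.Basis.mk hΔ.1 hΔ.2.ge
  refine ⟨b.constr ℝ fun w => p w, fun w hw => ?_⟩
  have := b.constr_basis ℝ (fun w : Δ => p w) ⟨w, hw⟩
  simpa [b] using this

theorem IsAffBasis.exists_coeff {Δ : Finset (Fin r)} (hΔ : IsAffBasis v Δ)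
    (y : Fin (d + 1) → ℝ) : ∃ a : Fin r → ℝ, y = ∑ w ∈ Δ, a w • homog (v w) := by
  classical
  have hy : y ∈ Submodule.span ℝ (Set.range fun w : Δ => homog (v w)) := by
    rw [hΔ.2]; trivial
  obtain ⟨c, rfl⟩ := (Submodule.mem_span_range_iff_exists_fun ℝ).1 hy
  refine ⟨fun w => if h : w ∈ Δ then c ⟨w, h⟩ else 0, ?_⟩
  rw [← Finset.sum_coe_sort Δ]
  exact Finset.sum_congr rfl fun w _ => by simp

theorem IsAffBasis.coeff_eq_zero {Δ : Finset (Fin r)} (hΔ : IsAffBasis v Δ) {a : Fin r → ℝ}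
    (ha : ∑ w ∈ Δ, a w • homog (v w) = 0) : ∀ w ∈ Δ, a w = 0 := by
  rw [← Finset.sum_coe_sort Δ] at ha
  exact fun w hw => Fintype.linearIndependent_iff.1 hΔ.1 (fun w => a w) ha ⟨w, hw⟩

theorem exists_isAffBasis_subset {B : Finset (Fin r)}
    (hB : affineSpan ℝ (v '' (B : Set (Fin r))) = ⊤) : ∃ Δ ⊆ B, IsAffBasis v Δ := by
  rw [affineSpan_eq_top_iff] at hB
  obtain ⟨b, hbB, -, hspan, hli⟩ := exists_linearIndepOn_extension
    (linearIndepOn_empty ℝ fun i => homog (v i)) (Set.empty_subset (B : Set (Fin r)))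
  have hfin : b.Finite := B.finite_toSet.subset hbB
  lift b to Finset (Fin r) using hfin
  refine ⟨b, by simpa using hbB, hli, ?_⟩
  rw [eq_top_iff, ← hB, Submodule.span_le]
  refine hspan.trans (le_of_eq ?_)
  congr 2
  ext y
  simp

/-- The cone of linear relations among the homogenized points whose coefficients off `B` are
nonnegative. When `B` is full-dimensional this is the contribution of the cell `B` to the
condition cone. -/
def relCone (v : Fin r → (Fin d → ℝ)) (B : Finset (Fin r)) : Set (Fin r → ℝ) :=
  {u | ∑ k, u k • homog (v k) = 0 ∧ ∀ k ∉ B, 0 ≤ u k}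

theorem relVec_apply (i : Fin r) (Δ : Finset (Fin r)) (a : Fin r → ℝ) (k : Fin r) :
    relVec i Δ a k = (if k = i then 1 else 0) - if k ∈ Δ then a k else 0 := by
  classical
  simp [relVec, Pi.single_apply, Finset.sum_apply]

theorem sum_relVec_smul {F : Type*} [AddCommGroup F] [Module ℝ F] (i : Fin r)
    (Δ : Finset (Fin r)) (a : Fin r → ℝ) (p : Fin r → F) :
    ∑ k, relVec i Δ a k • p k = p i - ∑ w ∈ Δ, a w • p w := by
  simp [relVec_apply, sub_smul, ite_smul, Finset.sum_sub_distrib]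

/-- Every linear relation is the combination of the relations `u_{k,Δ}` with its own coefficients,
because an affine basis `Δ` supports no nontrivial relation. -/
theorem eq_sum_smul_relVec {Δ : Finset (Fin r)} (hΔ : IsAffBasis v Δ) {a : Fin r → Fin r → ℝ}
    (ha : ∀ k, homog (v k) = ∑ w ∈ Δ, a k w • homog (v w)) {u : Fin r → ℝ}
    (hu : ∑ k, u k • homog (v k) = 0) : u = ∑ k, u k • relVec k Δ (a k) := by
  have h0 : ∀ w ∈ Δ, ∑ k, u k * a k w = 0 := by
    refine hΔ.coeff_eq_zero (a := fun w => ∑ k, u k * a k w) ?_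
    rw [← hu]
    simp_rw [Finset.sum_smul]
    rw [Finset.sum_comm]
    refine Finset.sum_congr rfl fun k _ => ?_
    conv_rhs => rw [ha k, Finset.smul_sum]
    exact Finset.sum_congr rfl fun w _ => mul_smul _ _ _
  ext j
  simp only [Finset.sum_apply, Pi.smul_apply, relVec_apply, smul_eq_mul, mul_sub,
    Finset.sum_sub_distrib]
  by_cases hj : j ∈ Δ
  · simp [hj, h0 j hj]
  · simp [hj]

theorem condGens_subset_relCone {𝒬 : Subdivision v} {u : Fin r → ℝ} (hu : u ∈ condGens 𝒬) :
    ∃ B ∈ 𝒬.cells, u ∈ relCone v B := by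
  obtain ⟨B, hB, Δ, hΔB, -, i, a, ha, hu⟩ := hu
  have hsum : ∑ k, relVec i Δ a k • homog (v k) = 0 := by
    rw [sum_relVec_smul, ha, sub_self]
  have hΔ : ∀ k ∉ B, k ∉ Δ := fun k hk h => hk (hΔB h)
  refine ⟨B, hB, ?_⟩
  rcases hu with rfl | ⟨hi, rfl⟩
  · refine ⟨hsum, fun k hk => ?_⟩
    rw [relVec_apply, if_neg (hΔ k hk), sub_zero]
    split_ifs <;> norm_num
  · refine ⟨by simp [Finset.sum_neg_distrib, hsum], fun k hk => ?_⟩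
    rw [Pi.neg_apply, relVec_apply, if_neg (hΔ k hk), if_neg (by rintro rfl; exact hk hi)]
    simp

/-- The relations `u_{k,Δ}` generate the cone of relations of any set of points `B`, in the sense
that a cone contains the latter as soon as it contains all `u_{k,Δ}`, with both signs for the
points of `B`. -/
theorem relCone_subset_of_relVec_mem {B Δ : Finset (Fin r)} (hΔ : IsAffBasis v Δ)
    (D : PointedCone ℝ (Fin r → ℝ))
    (h1 : ∀ i a, homog (v i) = ∑ w ∈ Δ, a w • homog (v w) → relVec i Δ a ∈ D)
    (h2 : ∀ i ∈ B, ∀ a, homog (v i) = ∑ w ∈ Δ, a w • homog (v w) → -relVec i Δ a ∈ D) :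
    relCone v B ⊆ D := by
  rintro u ⟨hu0, hu⟩
  choose a ha using fun k => hΔ.exists_coeff (homog (v k))
  rw [eq_sum_smul_relVec hΔ ha hu0]
  refine Submodule.sum_mem _ fun k _ => ?_
  rcases le_or_gt 0 (u k) with hk | hk
  · exact PointedCone.smul_mem _ hk (h1 k _ (ha k))
  · rw [← neg_smul_neg]
    refine PointedCone.smul_mem _ (neg_nonneg.2 hk.le) (h2 k ?_ _ (ha k))
    by_contra hkB
    exact hk.not_ge (hu k hkB)

theorem relCone_subset_condCone (𝒬 : Subdivision v) {B : Finset (Fin r)} (hB : B ∈ 𝒬.cells) :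
    relCone v B ⊆ condCone 𝒬 := by
  obtain ⟨Δ, hΔB, hΔ⟩ := exists_isAffBasis_subset (𝒬.isSubdivision.fullDim B hB)
  exact relCone_subset_of_relVec_mem hΔ _
    (fun i a ha => Submodule.subset_span ⟨B, hB, Δ, hΔB, hΔ, i, a, ha, Or.inl rfl⟩)
    (fun i hi a ha => Submodule.subset_span ⟨B, hB, Δ, hΔB, hΔ, i, a, ha, Or.inr ⟨hi, rfl⟩⟩)

theorem relCone_mono {B B' : Finset (Fin r)} (h : B ⊆ B') : relCone v B ⊆ relCone v B' :=
  fun _ hu => ⟨hu.1, fun k hk => hu.2 k fun h' => hk (h h')⟩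

theorem condGens_finite (𝒬 : Subdivision v) : (condGens 𝒬).Finite := by
  let S : Finset (Fin r) → Fin r → Set (Fin r → ℝ) := fun Δ i =>
    {u | IsAffBasis v Δ ∧ ∃ a : Fin r → ℝ, homog (v i) = ∑ w ∈ Δ, a w • homog (v w) ∧
      u = relVec i Δ a}
  have hS : ∀ Δ i, (S Δ i).Subsingleton := by
    rintro Δ i _ ⟨hΔ, a, ha, rfl⟩ _ ⟨-, a', ha', rfl⟩
    have h0 := hΔ.coeff_eq_zero (a := a - a') (by simp [sub_smul, ← ha, ← ha'])
    ext k
    rw [relVec_apply, relVec_apply]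
    by_cases hk : k ∈ Δ
    · have := h0 k hk
      simp only [Pi.sub_apply] at this
      rw [sub_eq_zero.1 this]
    · simp [hk]
  refine Set.Finite.subset (s := ⋃ Δ, ⋃ i, (S Δ i ∪ -S Δ i))
    (Set.finite_iUnion fun Δ => Set.finite_iUnion fun i =>
      (hS Δ i).finite.union (hS Δ i).finite.neg) ?_
  rintro u ⟨B, -, Δ, -, hΔ, i, a, ha, hu⟩
  refine Set.mem_iUnion.2 ⟨Δ, Set.mem_iUnion.2 ⟨i, ?_⟩⟩
  rcases hu with rfl | ⟨-, rfl⟩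
  · exact Or.inl ⟨hΔ, a, ha, rfl⟩
  · exact Or.inr ⟨hΔ, a, ha, neg_neg _⟩

theorem isPolyhedralCone_condCone (𝒬 : Subdivision v) : IsPolyhedralCone (condCone 𝒬) :=
  ⟨(condGens_finite 𝒬).toFinset, by simp [condCone]⟩

/-! ### Supporting functionals -/

/-- On linear relations, the heights `Λ` may be replaced by their differences to any linear map. -/
theorem apply_eq_sum_smul_sub {F : Type*} [AddCommGroup F] [Module ℝ F]
    {Λ : (Fin r → ℝ) →ₗ[ℝ] F} (ℓ : (Fin (d + 1) → ℝ) →ₗ[ℝ] F) {u : Fin r → ℝ} (hu : ∑ k, u k • homog (v k) = 0) :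
    Λ u = ∑ k, u k • (Λ (Pi.single k 1) - ℓ (homog (v k))) := by
  simp only [smul_sub, Finset.sum_sub_distrib, ← map_smul, ← map_sum, hu, map_zero, sub_zero]
  congr 1
  exact pi_eq_sum_univ' u

section Supports

variable {F : Type*} [AddCommGroup F] [LinearOrder F] [IsOrderedAddMonoid F] [Module ℝ F]

/-- The linear map `ℓ` on `ℝ^n` lies above the heights `Λ e_i` at the points `(1, v_i)`. -/
def Supports (v : Fin r → (Fin d → ℝ)) (Λ : (Fin r → ℝ) →ₗ[ℝ] F)
    (ℓ : (Fin (d + 1) → ℝ) →ₗ[ℝ] F) : Prop :=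
  ∀ i, Λ (Pi.single i 1) ≤ ℓ (homog (v i))

theorem apply_nonpos_of_supports [PosSMulMono ℝ F] {Λ : (Fin r → ℝ) →ₗ[ℝ] F}
    {ℓ : (Fin (d + 1) → ℝ) →ₗ[ℝ] F} (hℓ : Supports v Λ ℓ) {B : Finset (Fin r)}
    (hB : ∀ i ∈ B, ℓ (homog (v i)) = Λ (Pi.single i 1)) {u : Fin r → ℝ} (hu : u ∈ relCone v B) :
    Λ u ≤ 0 := by
  rw [apply_eq_sum_smul_sub ℓ hu.1]
  refine Finset.sum_nonpos fun k _ => ?_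
  by_cases hk : k ∈ B
  · simp [hB k hk]
  · exact smul_nonpos_of_nonneg_of_nonpos (hu.2 k hk) (sub_nonpos.2 (hℓ k))

/-- Heights are nonpositive on the condition cone exactly when every cell carries a linear map
that interpolates the heights on the cell and supports them elsewhere. -/
theorem condGens_nonpos_iff [PosSMulMono ℝ F] (𝒬 : Subdivision v) (Λ : (Fin r → ℝ) →ₗ[ℝ] F) :
    (∀ u ∈ condGens 𝒬, Λ u ≤ 0) ↔ ∀ B ∈ 𝒬.cells, ∃ ℓ : (Fin (d + 1) → ℝ) →ₗ[ℝ] F,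
      Supports v Λ ℓ ∧ ∀ i ∈ B, ℓ (homog (v i)) = Λ (Pi.single i 1) := by
  constructor
  · intro h B hB
    obtain ⟨Δ, hΔB, hΔ⟩ := exists_isAffBasis_subset (𝒬.isSubdivision.fullDim B hB)
    obtain ⟨ℓ, hℓ⟩ := hΔ.exists_linear fun w => Λ (Pi.single w 1)
    have key : ∀ i a, homog (v i) = ∑ w ∈ Δ, a w • homog (v w) →
        Λ (relVec i Δ a) = Λ (Pi.single i 1) - ℓ (homog (v i)) := by
      intro i a ha
      rw [ha, map_sum, relVec, map_sub, map_sum]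
      congr 1
      exact Finset.sum_congr rfl fun w hw => by rw [map_smul, map_smul, hℓ w hw]
    have hsupp : Supports v Λ ℓ := fun i => by
      obtain ⟨a, ha⟩ := hΔ.exists_coeff (homog (v i))
      rw [← sub_nonpos, ← key i a ha]
      exact h _ ⟨B, hB, Δ, hΔB, hΔ, i, a, ha, Or.inl rfl⟩
    refine ⟨ℓ, hsupp, fun i hi => le_antisymm ?_ (hsupp i)⟩
    obtain ⟨a, ha⟩ := hΔ.exists_coeff (homog (v i))
    have := h _ ⟨B, hB, Δ, hΔB, hΔ, i, a, ha, Or.inr ⟨hi, rfl⟩⟩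
    rwa [map_neg, key i a ha, neg_sub, sub_nonpos] at this
  · intro h u hu
    obtain ⟨B, hB, huB⟩ := condGens_subset_relCone hu
    obtain ⟨ℓ, hℓ, hℓB⟩ := h B hB
    exact apply_nonpos_of_supports hℓ hℓB huB

/-- On the cone over a cell, the linear map interpolating the heights of the cell lies below every
supporting linear map. -/
theorem Supports.le_of_mem_hull [PosSMulMono ℝ F] {Λ : (Fin r → ℝ) →ₗ[ℝ] F}
    {ℓ ℓ' : (Fin (d + 1) → ℝ) →ₗ[ℝ] F} (hℓ' : Supports v Λ ℓ') {B : Finset (Fin r)}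
    (hB : ∀ i ∈ B, ℓ (homog (v i)) = Λ (Pi.single i 1)) {y : Fin (d + 1) → ℝ}
    (hy : y ∈ PointedCone.hull ℝ ((fun i => homog (v i)) '' (B : Set (Fin r)))) :
    ℓ y ≤ ℓ' y := by
  rw [← sub_nonpos]
  refine dual_nonpos_of_mem_hull (f := ℓ - ℓ') ?_ hy
  rintro _ ⟨i, hi, rfl⟩
  rw [LinearMap.sub_apply, sub_nonpos, hB i hi]
  exact hℓ' i

theorem Supports.le_of_mem_poly [PosSMulMono ℝ F] {Λ : (Fin r → ℝ) →ₗ[ℝ] F}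
    {ℓ ℓ' : (Fin (d + 1) → ℝ) →ₗ[ℝ] F} (hℓ' : Supports v Λ ℓ') {B : Finset (Fin r)}
    (hB : ∀ i ∈ B, ℓ (homog (v i)) = Λ (Pi.single i 1)) {x : Fin d → ℝ} (hx : x ∈ poly v B) :
    ℓ (homog x) ≤ ℓ' (homog x) :=
  hℓ'.le_of_mem_hull hB (homog_mem_hull_iff.2 hx)

end Supports

/-! ### The closed GKZ-cone is the polar of the condition cone -/

theorem nonempty_of_fullDim {B : Finset (Fin r)}
    (hB : affineSpan ℝ (v '' (B : Set (Fin r))) = ⊤) : B.Nonempty := by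
  by_contra h
  rw [Finset.not_nonempty_iff_eq_empty] at h
  subst h
  simp at hB

theorem interior_poly_nonempty {B : Finset (Fin r)}
    (hB : affineSpan ℝ (v '' (B : Set (Fin r))) = ⊤) : (interior (poly v B)).Nonempty :=
  interior_convexHull_nonempty_iff_affineSpan_eq_top.2 hB

theorem Subdivision.nonempty_univ (𝒬 : Subdivision v)
    (hspan : affineSpan ℝ (Set.range v) = ⊤) : 𝒬.cells.Nonempty := by
  have h : (poly v Finset.univ).Nonempty :=
    (interior_poly_nonempty (by simpa using hspan)).mono interior_subset
  rw [← 𝒬.isSubdivision.cover] at h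
  obtain ⟨x, hx⟩ := h
  simp only [Set.mem_iUnion] at hx
  obtain ⟨B, hB, -⟩ := hx
  exact ⟨B, hB⟩

/-- The linear map on a cell lies above a concave `g`, because `g` is concave along segments leaving
the interior of the cell; conversely, the minimum of the linear maps belonging to the cells is
concave, and equals each of them on its own cell. -/
theorem closedCone_eq_polar (hspan : affineSpan ℝ (Set.range v) = ⊤) (𝒬 : Subdivision v) :
    closedCone 𝒬 N = polar N (condCone 𝒬) := by
  ext Ψ
  rw [condCone, mem_polar_hull_iff, condGens_nonpos_iff]
  constructor
  · rintro ⟨g, hlin, ⟨-, hconc⟩, hmark, hunmark⟩ B hB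
    obtain ⟨ψ, hψ⟩ := hlin B hB
    have hK : ∀ x ∈ poly v B, g (homog x) = ψ (homog x) := fun x hx =>
      hψ ⟨1, zero_le_one, x, hx, (one_smul _ _).symm⟩
    have hΨg : ∀ i, LexLE (fun k => Ψ k i) (g (homog (v i))) := fun i => by
      by_cases hi : i ∈ 𝒬.marked
      · rw [hmark i hi]; exact le_rfl
      · exact hunmark i hi
    refine ⟨(toLexLinearEquiv ℝ (Fin N → ℝ)).toLinearMap ∘ₗ ψ, fun j => ?_, fun i hi => ?_⟩
    · rw [lexMap_single]
      refine (hΨg j).trans ?_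
      -- concavity along a short segment from an interior point `x` of the cell towards `v j`
      obtain ⟨x, hx⟩ := interior_poly_nonempty (𝒬.isSubdivision.fullDim B hB)
      have hcont : Filter.Tendsto (fun t : ℝ => t • v j + (1 - t) • x) (nhdsWithin 0 (Set.Ioi 0))
          (nhds x) := by
        have : Continuous fun t : ℝ => t • v j + (1 - t) • x := by fun_prop
        have h := this.tendsto 0
        simp only [zero_smul, sub_zero, one_smul, zero_add] at h
        exact h.mono_left nhdsWithin_le_nhds
      have hev := (hcont.eventually (isOpen_interior.mem_nhds hx)).and
        (Ioo_mem_nhdsGT (zero_lt_one (α := ℝ)))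
      obtain ⟨t, ht, ht0, ht1⟩ := hev.exists
      have hP : ∀ y ∈ poly v (Finset.univ : Finset (Fin r)),
          homog y ∈ coneOver (poly v Finset.univ) := fun y hy =>
        ⟨1, zero_le_one, y, hy, (one_smul _ _).symm⟩
      have hxB := interior_subset hx
      have h := hconc _ (hP (v j) (subset_poly (Finset.mem_univ j))) _
        (hP x (poly_mono (Finset.subset_univ B) hxB)) t ht0.le ht1.le
      rw [← homog_combo (by ring), hK _ (interior_subset ht), homog_combo (by ring), map_add,
        map_smul, map_smul, hK x hxB] at h
      have h' : t • toLex (g (homog (v j))) + (1 - t) • toLex (ψ (homog x)) ≤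
        t • toLex (ψ (homog (v j))) + (1 - t) • toLex (ψ (homog x)) := h
      rw [add_le_add_iff_right] at h'
      exact le_of_smul_le_smul_left h' ht0
    · rw [lexMap_single]
      have : g (homog (v i)) = fun k => Ψ k i := hmark i ⟨B, hB, hi⟩
      rw [← this, hK _ (subset_poly hi)]
      rfl
  · intro h
    choose! ℓ hℓ hℓB using h
    have hne := 𝒬.nonempty_univ hspan
    choose B hB hBmin using fun y => 𝒬.cells.exists_min_image (fun B => ℓ B y) hne
    have hcell : ∀ B' ∈ 𝒬.cells, ∀ y ∈ coneOver (poly v B'), ℓ (B y) y = ℓ B' y := by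
      intro B' hB' y hy
      rw [coneOver_poly (nonempty_of_fullDim (𝒬.isSubdivision.fullDim B' hB'))] at hy
      exact le_antisymm (hBmin y B' hB') ((hℓ _ (hB y)).le_of_mem_hull (hℓB B' hB') hy)
    have hpl : IsPiecewiseLinear 𝒬 fun y => ofLex (ℓ (B y) y) := fun B' hB' =>
      ⟨(toLexLinearEquiv ℝ (Fin N → ℝ)).symm.toLinearMap ∘ₗ ℓ B', fun y hy =>
        congrArg ofLex (hcell B' hB' y hy)⟩
    refine ⟨fun y => ofLex (ℓ (B y) y), hpl, ⟨?_, ?_⟩, ?_, ?_⟩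
    · have hcov : coneOver (poly v Finset.univ) = ⋃ B' : 𝒬.cells, coneOver (poly v B'.1) := by
        rw [← 𝒬.isSubdivision.cover]
        ext y
        simp only [coneOver, Set.mem_iUnion, Set.mem_ofPred_eq]
        constructor
        · rintro ⟨c, hc, x, ⟨B', hB', hx⟩, rfl⟩
          exact ⟨⟨B', hB'⟩, c, hc, x, hx, rfl⟩
        · rintro ⟨⟨B', hB'⟩, c, hc, x, hx, rfl⟩
          exact ⟨c, hc, x, ⟨B', hB', hx⟩, rfl⟩
      rw [hcov]
      refine (locallyFinite_of_finite _).continuousOn_iUnion (fun B' => ?_) fun B' => ?_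
      · rw [coneOver_poly (nonempty_of_fullDim (𝒬.isSubdivision.fullDim _ B'.2))]
        exact isClosed_hull (Set.toFinite _)
      · obtain ⟨ψ, hψ⟩ := hpl _ B'.2
        exact (LinearMap.continuous_of_finiteDimensional ψ).continuousOn.congr hψ
    · intro x _ y _ t ht0 ht1
      set z := t • x + (1 - t) • y with hz
      change t • ℓ (B x) x + (1 - t) • ℓ (B y) y ≤ ℓ (B z) z
      conv_rhs => rw [hz, map_add, map_smul, map_smul]
      exact add_le_add (smul_le_smul_of_nonneg_left (hBmin x _ (hB z)) ht0)
        (smul_le_smul_of_nonneg_left (hBmin y _ (hB z)) (sub_nonneg.2 ht1))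
    · rintro i ⟨B', hB', hi⟩
      have h1 := hcell B' hB' (homog (v i)) ⟨1, zero_le_one, v i, subset_poly hi, by simp⟩
      change ofLex (ℓ (B _) _) = _
      rw [h1, hℓB B' hB' i hi, lexMap_single]
      rfl
    · intro i _
      have := hℓ _ (hB (homog (v i))) i
      rw [lexMap_single] at this
      exact this

/-! ### The subdivision induced by a height function -/

open Classical in
/-- The points at which a supporting functional `ℓ` touches the heights `φ e_i`. -/
noncomputable def contact (v : Fin r → (Fin d → ℝ)) (φ : Module.Dual ℝ (Fin r → ℝ))
    (ℓ : Module.Dual ℝ (Fin (d + 1) → ℝ)) : Finset (Fin r) :=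
  Finset.univ.filter fun i => ℓ (homog (v i)) = φ (Pi.single i 1)

theorem mem_contact {φ : Module.Dual ℝ (Fin r → ℝ)} {ℓ : Module.Dual ℝ (Fin (d + 1) → ℝ)}
    {i : Fin r} : i ∈ contact v φ ℓ ↔ ℓ (homog (v i)) = φ (Pi.single i 1) := by
  simp [contact]

open Classical in
/-- The cells of the subdivision induced by the heights `φ e_i`: the full-dimensional contact sets
of supporting functionals, i.e. the upper facets of the lifted configuration. -/
noncomputable def inducedCells (v : Fin r → (Fin d → ℝ)) (φ : Module.Dual ℝ (Fin r → ℝ)) :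
    Finset (Finset (Fin r)) :=
  Finset.univ.filter fun T => affineSpan ℝ (v '' (T : Set (Fin r))) = ⊤ ∧
    ∃ ℓ : Module.Dual ℝ (Fin (d + 1) → ℝ), Supports v φ ℓ ∧ T = contact v φ ℓ

theorem mem_inducedCells {φ : Module.Dual ℝ (Fin r → ℝ)} {T : Finset (Fin r)} :
    T ∈ inducedCells v φ ↔ affineSpan ℝ (v '' (T : Set (Fin r))) = ⊤ ∧
      ∃ ℓ : Module.Dual ℝ (Fin (d + 1) → ℝ), Supports v φ ℓ ∧ T = contact v φ ℓ := by
  simp [inducedCells]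

theorem linearMap_eq_of_fullDim {F : Type*} [AddCommGroup F] [Module ℝ F] {B : Finset (Fin r)}
    (hB : affineSpan ℝ (v '' (B : Set (Fin r))) = ⊤) {ℓ ℓ' : (Fin (d + 1) → ℝ) →ₗ[ℝ] F}
    (h : ∀ i ∈ B, ℓ (homog (v i)) = ℓ' (homog (v i))) : ℓ = ℓ' := by
  rw [← sub_eq_zero]
  refine dual_eq_zero_of_affineSpan hB ?_
  rintro _ ⟨i, hi, rfl⟩
  simp [h i hi]

theorem exists_supports (φ : Module.Dual ℝ (Fin r → ℝ)) :
    ∃ ℓ : Module.Dual ℝ (Fin (d + 1) → ℝ), Supports v φ ℓ := by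
  obtain ⟨M, hM⟩ := (Set.finite_range fun i => φ (Pi.single i 1)).bddAbove
  exact ⟨M • LinearMap.proj 0, fun i => by simpa [homog] using hM ⟨i, rfl⟩⟩

/-- A supporting functional whose contact set is not full-dimensional can be tilted about its
contact set, without increasing at a given point of the polytope, until it touches one more
point. -/
theorem exists_supports_contact_ssubset (hspan : affineSpan ℝ (Set.range v) = ⊤)
    {φ : Module.Dual ℝ (Fin r → ℝ)} {x : Fin d → ℝ} (hx : x ∈ poly v Finset.univ)
    {ℓ : Module.Dual ℝ (Fin (d + 1) → ℝ)} (hℓ : Supports v φ ℓ)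
    (hT : affineSpan ℝ (v '' (contact v φ ℓ : Set (Fin r))) ≠ ⊤) :
    ∃ ℓ' : Module.Dual ℝ (Fin (d + 1) → ℝ), Supports v φ ℓ' ∧ ℓ' (homog x) ≤ ℓ (homog x) ∧
      contact v φ ℓ ⊂ contact v φ ℓ' := by
  obtain ⟨m, hm, hmx, hmi⟩ : ∃ m : Module.Dual ℝ (Fin (d + 1) → ℝ),
      (∀ i ∈ contact v φ ℓ, m (homog (v i)) = 0) ∧ m (homog x) ≤ 0 ∧
        ∃ i, m (homog (v i)) < 0 := by
    rw [Ne, affineSpan_eq_top_iff] at hT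
    obtain ⟨m, hm, hle⟩ := Submodule.exists_le_ker_of_lt_top _ (lt_top_iff_ne_top.2 hT)
    have hm0 : ∀ i ∈ contact v φ ℓ, m (homog (v i)) = 0 := fun i hi =>
      hle (Submodule.subset_span ⟨i, hi, rfl⟩)
    have hneg : ∀ m : Module.Dual ℝ (Fin (d + 1) → ℝ), m (homog x) < 0 →
        ∃ i, m (homog (v i)) < 0 := by
      intro m hmx
      by_contra! h
      have := dual_nonpos_of_mem_hull (f := -m) (x := homog x) ?_ (homog_mem_hull_iff.2 hx)
      · simp at this; linarith
      · rintro _ ⟨i, -, rfl⟩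
        simpa using h i
    rcases lt_trichotomy (m (homog x)) 0 with h | h | h
    · exact ⟨m, hm0, h.le, hneg m h⟩
    · obtain ⟨i, hi⟩ : ∃ i, m (homog (v i)) ≠ 0 := by
        by_contra! h
        exact hm (dual_eq_zero_of_affineSpan hspan (by rintro _ ⟨i, rfl⟩; exact h i))
      rcases hi.lt_or_gt with hi | hi
      · exact ⟨m, hm0, h.le, i, hi⟩
      · exact ⟨-m, fun i hi => by simp [hm0 i hi], by simp [h], i, by simpa using hi⟩
    · have : (-m) (homog x) < 0 := by simpa using h
      exact ⟨-m, fun i hi => by simp [hm0 i hi], this.le, hneg _ this⟩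
  obtain ⟨i₁, hi₁⟩ := hmi
  -- the first point that the tilting functional meets
  obtain ⟨i₀, hi₀, hmin⟩ := (Finset.univ.filter fun i => m (homog (v i)) < 0).exists_min_image
    (fun i => (ℓ (homog (v i)) - φ (Pi.single i 1)) / -m (homog (v i)))
    ⟨i₁, by simpa using hi₁⟩
  have hi₀' : m (homog (v i₀)) < 0 := by simpa using hi₀
  set s := (ℓ (homog (v i₀)) - φ (Pi.single i₀ 1)) / -m (homog (v i₀)) with hs
  have hs0 : 0 ≤ s := div_nonneg (sub_nonneg.2 (hℓ i₀)) (by linarith)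
  refine ⟨ℓ + s • m, fun i => ?_, ?_, ?_⟩
  · simp only [LinearMap.add_apply, LinearMap.smul_apply, smul_eq_mul]
    rcases lt_or_ge (m (homog (v i))) 0 with h | h
    · have := hmin i (by simpa using h)
      rw [le_div_iff₀ (by linarith)] at this
      linarith
    · exact (hℓ i).trans (le_add_of_nonneg_right (mul_nonneg hs0 h))
  · simpa using mul_nonpos_of_nonneg_of_nonpos hs0 hmx
  · refine (Finset.ssubset_iff_of_subset fun i hi => ?_).2 ⟨i₀, ?_, fun h => hi₀'.ne (hm i₀ h)⟩
    · rw [mem_contact] at hi ⊢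
      simp [hm i (mem_contact.2 hi), hi]
    · rw [mem_contact, LinearMap.add_apply, LinearMap.smul_apply, smul_eq_mul, hs]
      have hne := hi₀'.ne
      field_simp
      ring

theorem exists_supports_fullDim (hspan : affineSpan ℝ (Set.range v) = ⊤)
    {φ : Module.Dual ℝ (Fin r → ℝ)} {x : Fin d → ℝ} (hx : x ∈ poly v Finset.univ)
    {ℓ : Module.Dual ℝ (Fin (d + 1) → ℝ)} (hℓ : Supports v φ ℓ) :
    ∃ ℓ' : Module.Dual ℝ (Fin (d + 1) → ℝ), Supports v φ ℓ' ∧ ℓ' (homog x) ≤ ℓ (homog x) ∧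
      affineSpan ℝ (v '' (contact v φ ℓ' : Set (Fin r))) = ⊤ := by
  by_cases hT : affineSpan ℝ (v '' (contact v φ ℓ : Set (Fin r))) = ⊤
  · exact ⟨ℓ, hℓ, le_rfl, hT⟩
  · obtain ⟨ℓ₁, hℓ₁, hle₁, hlt⟩ := exists_supports_contact_ssubset hspan hx hℓ hT
    obtain ⟨ℓ', hℓ', hle', h⟩ := exists_supports_fullDim hspan hx hℓ₁
    exact ⟨ℓ', hℓ', hle'.trans hle₁, h⟩
termination_by r - (contact v φ ℓ).card
decreasing_by
  have h1 := Finset.card_lt_card hlt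
  have h2 := (contact v φ ℓ₁).card_le_univ
  rw [Fintype.card_fin] at h2
  omega

/-- The cells of the induced subdivision cover the polytope: `x` lies in the contact set of a
supporting functional `ℓ` that is minimal at `x`. Otherwise Farkas' lemma gives a direction in
which `ℓ` can be lowered at `x`. -/
theorem exists_mem_inducedCells (hspan : affineSpan ℝ (Set.range v) = ⊤)
    (φ : Module.Dual ℝ (Fin r → ℝ)) {x : Fin d → ℝ} (hx : x ∈ poly v Finset.univ) :
    ∃ T ∈ inducedCells v φ, x ∈ poly v T := by
  have hcell : ∀ T ∈ inducedCells v φ, ∃ ℓ : Module.Dual ℝ (Fin (d + 1) → ℝ),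
      Supports v φ ℓ ∧ T = contact v φ ℓ := fun T hT => (mem_inducedCells.1 hT).2
  choose! ℓ hℓ hℓT using hcell
  obtain ⟨ℓ₀, hℓ₀⟩ := exists_supports (v := v) φ
  obtain ⟨ℓ₁, hℓ₁, -, h₁⟩ := exists_supports_fullDim hspan hx hℓ₀
  obtain ⟨T, hT, hmin⟩ := (inducedCells v φ).exists_min_image (fun T => ℓ T (homog x))
    ⟨_, mem_inducedCells.2 ⟨h₁, ℓ₁, hℓ₁, rfl⟩⟩
  refine ⟨T, hT, ?_⟩
  by_contra hxT
  rw [← homog_mem_hull_iff] at hxT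
  obtain ⟨m, hm, hmx⟩ := exists_dual_of_notMem_hull (Set.toFinite _) hxT
  have hev : ∀ᶠ s : ℝ in nhdsWithin 0 (Set.Ioi 0), Supports v φ (ℓ T - s • m) := by
    refine Filter.eventually_all.2 fun i => ?_
    by_cases hi : i ∈ T
    · filter_upwards [self_mem_nhdsWithin] with s hs
      have h1 := mul_nonpos_of_nonneg_of_nonpos (le_of_lt hs) (hm _ ⟨i, hi, rfl⟩)
      have h2 := hℓ T hT i
      simp only [LinearMap.sub_apply, LinearMap.smul_apply, smul_eq_mul]
      simp only at h1
      linarith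
    · have hlt : φ (Pi.single i 1) < ℓ T (homog (v i)) := by
        refine (hℓ T hT i).lt_of_ne fun h => hi ?_
        rw [hℓT T hT]
        exact mem_contact.2 h.symm
      have hcont : Continuous fun s : ℝ => (ℓ T - s • m) (homog (v i)) := by
        simp only [LinearMap.sub_apply, LinearMap.smul_apply, smul_eq_mul]
        fun_prop
      have := (hcont.tendsto 0).eventually_const_lt (by simpa using hlt)
      exact (this.filter_mono nhdsWithin_le_nhds).mono fun s hs => hs.le
  obtain ⟨s, hs, hs0⟩ := (hev.and self_mem_nhdsWithin).exists
  obtain ⟨ℓ', hℓ', hle, hfull⟩ := exists_supports_fullDim hspan hx hs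
  have hT' : contact v φ ℓ' ∈ inducedCells v φ := mem_inducedCells.2 ⟨hfull, ℓ', hℓ', rfl⟩
  have heq : ℓ (contact v φ ℓ') = ℓ' := linearMap_eq_of_fullDim hfull fun i hi => by
    have h1 := hi
    rw [hℓT _ hT', mem_contact] at h1
    rw [h1, mem_contact.1 hi]
  have h1 := hmin _ hT'
  rw [heq] at h1
  have h2 : 0 < s * m (homog x) := mul_pos hs0 hmx
  simp only [LinearMap.sub_apply, LinearMap.smul_apply, smul_eq_mul] at hle
  linarith

theorem contact_apply {φ : Module.Dual ℝ (Fin r → ℝ)} {ℓ : Module.Dual ℝ (Fin (d + 1) → ℝ)} :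
    ∀ i ∈ contact v φ ℓ, ℓ (homog (v i)) = φ (Pi.single i 1) := fun _ => mem_contact.1

/-- Two contact polytopes meet where their supporting functionals agree. -/
theorem mem_poly_contact_iff {φ : Module.Dual ℝ (Fin r → ℝ)}
    {ℓ ℓ' : Module.Dual ℝ (Fin (d + 1) → ℝ)} (hℓ : Supports v φ ℓ) (hℓ' : Supports v φ ℓ')
    {x : Fin d → ℝ} (hx : x ∈ poly v (contact v φ ℓ)) :
    x ∈ poly v (contact v φ ℓ') ↔ ℓ' (homog x) = ℓ (homog x) := by
  refine ⟨fun hx' => le_antisymm (hℓ.le_of_mem_poly contact_apply hx')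
    (hℓ'.le_of_mem_poly contact_apply hx), fun h => ?_⟩
  obtain ⟨t, ht, hxt⟩ := mem_hull_image_iff.1 (homog_mem_hull_iff.2 hx)
  have hsum : ∑ i ∈ contact v φ ℓ, t i * (ℓ' (homog (v i)) - ℓ (homog (v i))) = 0 := by
    rw [← hxt] at h
    simp only [map_sum, map_smul, smul_eq_mul] at h
    simp only [mul_sub, Finset.sum_sub_distrib, h, sub_self]
  rw [Finset.sum_eq_zero_iff_of_nonneg fun i hi => mul_nonneg (ht i hi) (sub_nonneg.2
    ((mem_contact.1 hi).trans_le (hℓ' i)))] at hsum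
  rw [← homog_mem_hull_iff, ← hxt]
  refine Submodule.sum_mem _ fun i hi => ?_
  rcases mul_eq_zero.1 (hsum i hi) with h0 | h0
  · simp [h0]
  · refine PointedCone.smul_mem _ (ht i hi) (Submodule.subset_span ⟨i, ?_, rfl⟩)
    exact mem_contact.2 ((sub_eq_zero.1 h0).trans (mem_contact.1 hi))

theorem isExposed_poly_contact_inter {φ : Module.Dual ℝ (Fin r → ℝ)}
    {ℓ ℓ' : Module.Dual ℝ (Fin (d + 1) → ℝ)} (hℓ : Supports v φ ℓ) (hℓ' : Supports v φ ℓ') :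
    IsExposed ℝ (poly v (contact v φ ℓ))
      (poly v (contact v φ ℓ) ∩ poly v (contact v φ ℓ')) := by
  rintro ⟨x₀, hx₀, hx₀'⟩
  let p : Module.Dual ℝ (Fin d → ℝ) :=
    (ℓ - ℓ') ∘ₗ (LinearMap.pi (Fin.cons 0 fun j => LinearMap.proj j))
  have hp : ∀ y, p y = ℓ (homog y) - ℓ' (homog y) - (ℓ - ℓ') (homog 0) := fun y => by
    rw [← LinearMap.sub_apply, ← map_sub]
    change (ℓ - ℓ') _ = _
    congr 1
    ext i
    refine Fin.cases ?_ (fun j => ?_) i <;> simp [homog]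
  refine ⟨LinearMap.toContinuousLinearMap p, Set.ext fun x => ⟨fun ⟨hx, hx'⟩ => ⟨hx, fun y hy => ?_⟩,
    fun ⟨hx, hmax⟩ => ⟨hx, ?_⟩⟩⟩
  · have h1 := (mem_poly_contact_iff hℓ hℓ' hx).1 hx'
    have h2 := hℓ'.le_of_mem_poly contact_apply hy
    simp only [LinearMap.coe_toContinuousLinearMap', hp]
    linarith
  · have h1 := (mem_poly_contact_iff hℓ hℓ' hx₀).1 hx₀'
    have h2 := hℓ'.le_of_mem_poly contact_apply hx
    have h3 := hmax x₀ hx₀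
    simp only [LinearMap.coe_toContinuousLinearMap', hp] at h3
    exact (mem_poly_contact_iff hℓ hℓ' hx).2 (by linarith)

/-- The subdivision of the configuration induced by the heights `φ e_i`. -/
noncomputable def inducedSubdivision (hspan : affineSpan ℝ (Set.range v) = ⊤)
    (φ : Module.Dual ℝ (Fin r → ℝ)) : Subdivision v where
  cells := inducedCells v φ
  isSubdivision :=
    { subset := fun B _ => Finset.subset_univ B
      fullDim := fun B hB => (mem_inducedCells.1 hB).1
      cover := by
        refine Set.Subset.antisymm (Set.iUnion₂_subset fun B _ => poly_mono B.subset_univ)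
          fun x hx => ?_
        obtain ⟨T, hT, hxT⟩ := exists_mem_inducedCells hspan φ hx
        exact Set.mem_iUnion₂.2 ⟨T, hT, hxT⟩
      face := by
        intro B hB B' hB' _
        obtain ⟨-, ℓ, hℓ, rfl⟩ := mem_inducedCells.1 hB
        obtain ⟨-, ℓ', hℓ', rfl⟩ := mem_inducedCells.1 hB'
        refine ⟨isExposed_poly_contact_inter hℓ hℓ', ?_⟩
        rw [Set.inter_comm]
        exact isExposed_poly_contact_inter hℓ' hℓ
      marking := by
        intro B hB B' hB' _ i hi
        obtain ⟨-, ℓ, hℓ, rfl⟩ := mem_inducedCells.1 hB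
        obtain ⟨-, ℓ', hℓ', rfl⟩ := mem_inducedCells.1 hB'
        rw [mem_contact, mem_contact, (mem_poly_contact_iff hℓ hℓ' hi.1).1 hi.2] }

/-! ### Refinement -/

/-- A face meeting the interior is everything: the functional exposing it has an interior maximum,
hence vanishes. -/
theorem _root_.IsExposed.eq_of_mem_interior {E : Type*} [NormedAddCommGroup E] [NormedSpace ℝ E]
    {A F : Set E} (h : IsExposed ℝ A F) {y : E} (hyF : y ∈ F) (hyA : y ∈ interior A) : F = A := by
  obtain ⟨l, rfl⟩ := h ⟨y, hyF⟩
  have hl : l = 0 := IsLocalMax.hasFDerivAt_eq_zero (f := l) (a := y)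
    (Filter.mem_of_superset (mem_interior_iff_mem_nhds.1 hyA) hyF.2) l.hasFDerivAt
  simp [hl]

theorem IsSubdivision.eq_of_mem_interior {S : Finset (Fin r)} {𝒬 : Finset (Finset (Fin r))}
    (h : IsSubdivision v S 𝒬) {B B' : Finset (Fin r)} (hB : B ∈ 𝒬) (hB' : B' ∈ 𝒬) {y : Fin d → ℝ}
    (hy : y ∈ interior (poly v B)) (hy' : y ∈ poly v B') : B = B' := by
  by_contra hne
  have h1 := (h.face B hB B' hB' hne).1.eq_of_mem_interior ⟨interior_subset hy, hy'⟩ hy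
  have hsub : poly v B ⊆ poly v B' := Set.inter_eq_left.1 h1
  have h2 := (h.face B hB B' hB' hne).2.eq_of_mem_interior ⟨interior_subset hy, hy'⟩
    (interior_mono hsub hy)
  have hsub' : poly v B' ⊆ poly v B := Set.inter_eq_right.1 h2
  have hmark := h.marking B hB B' hB' hne
  refine hne (Finset.ext fun i => ⟨fun hi => ?_, fun hi => ?_⟩)
  · exact (hmark i ⟨subset_poly hi, hsub (subset_poly hi)⟩).1 hi
  · exact (hmark i ⟨hsub' (subset_poly hi), subset_poly hi⟩).2 hi

theorem IsSubdivision.eq_of_poly_subset {S : Finset (Fin r)} {𝒬 : Finset (Finset (Fin r))}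
    (h : IsSubdivision v S 𝒬) {B B' : Finset (Fin r)} (hB : B ∈ 𝒬) (hB' : B' ∈ 𝒬)
    (hsub : poly v B ⊆ poly v B') : B = B' := by
  obtain ⟨y, hy⟩ := interior_poly_nonempty (h.fullDim B hB)
  exact h.eq_of_mem_interior hB hB' hy (hsub (interior_subset hy))

theorem Refines.exists_superset {𝒬 𝒬' : Subdivision v} (h : Refines 𝒬 𝒬') {B : Finset (Fin r)}
    (hB : B ∈ 𝒬.cells) : ∃ B' ∈ 𝒬'.cells, B ⊆ B' := by
  classical
  obtain ⟨y, hy⟩ := interior_poly_nonempty (𝒬.isSubdivision.fullDim B hB)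
  have hyP : y ∈ poly v Finset.univ := poly_mono B.subset_univ (interior_subset hy)
  rw [← 𝒬'.isSubdivision.cover] at hyP
  obtain ⟨B', hB', hyB'⟩ := Set.mem_iUnion₂.1 hyP
  have hsub := h B' hB'
  rw [← hsub.cover] at hyB'
  obtain ⟨B₁, hB₁, hyB₁⟩ := Set.mem_iUnion₂.1 hyB'
  have heq := 𝒬.isSubdivision.eq_of_mem_interior hB (Finset.mem_filter.1 hB₁).1 hy hyB₁
  exact ⟨B', hB', hsub.subset B (by rw [heq]; exact hB₁)⟩

theorem Refines.antisymm {𝒬 𝒬' : Subdivision v} (h : Refines 𝒬 𝒬') (h' : Refines 𝒬' 𝒬) :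
    𝒬 = 𝒬' := by
  have key : ∀ {𝒬 𝒬' : Subdivision v}, Refines 𝒬 𝒬' → Refines 𝒬' 𝒬 → 𝒬.cells ⊆ 𝒬'.cells := by
    intro 𝒬 𝒬' h h' B hB
    obtain ⟨B', hB', hsub⟩ := h.exists_superset hB
    obtain ⟨B'', hB'', hsub'⟩ := h'.exists_superset hB'
    have := 𝒬.isSubdivision.eq_of_poly_subset hB hB'' (poly_mono (hsub.trans hsub'))
    subst this
    rwa [hsub.antisymm hsub']
  exact Subdivision.ext (Finset.Subset.antisymm (key h h') (key h' h))

theorem Refines.condCone_subset {𝒬 𝒬' : Subdivision v} (h : Refines 𝒬 𝒬') :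
    condCone 𝒬 ⊆ condCone 𝒬' := by
  have : PointedCone.hull ℝ (condGens 𝒬) ≤ PointedCone.hull ℝ (condGens 𝒬') := by
    refine Submodule.span_le.2 fun u hu => ?_
    obtain ⟨B, hB, huB⟩ := condGens_subset_relCone hu
    obtain ⟨B', hB', hsub⟩ := h.exists_superset hB
    exact relCone_subset_condCone 𝒬' hB' (relCone_mono hsub huB)
  exact this

theorem inducedSubdivision_nonpos (hspan : affineSpan ℝ (Set.range v) = ⊤)
    (φ : Module.Dual ℝ (Fin r → ℝ)) :
    ∀ u ∈ condGens (inducedSubdivision hspan φ), φ u ≤ 0 := by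
  rw [condGens_nonpos_iff]
  intro B hB
  obtain ⟨-, ℓ, hℓ, rfl⟩ := mem_inducedCells.1 hB
  exact ⟨ℓ, hℓ, contact_apply⟩

theorem poly_subset_closure_interior {B : Finset (Fin r)}
    (hB : affineSpan ℝ (v '' (B : Set (Fin r))) = ⊤) :
    poly v B ⊆ closure (interior (poly v B)) := by
  rw [poly, Convex.closure_interior_eq_closure_of_nonempty_interior (𝕜 := ℝ) (convex_convexHull ℝ _)
    (interior_poly_nonempty hB)]
  exact subset_closure

/-- The subdivisions whose condition cone has `φ` in its polar are those refining the subdivision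
induced by `φ`. -/
theorem refines_inducedSubdivision_iff (hspan : affineSpan ℝ (Set.range v) = ⊤)
    {𝒬 : Subdivision v} {φ : Module.Dual ℝ (Fin r → ℝ)} :
    Refines 𝒬 (inducedSubdivision hspan φ) ↔ ∀ u ∈ condGens 𝒬, φ u ≤ 0 := by
  constructor
  · intro h u hu
    exact dual_nonpos_of_mem_hull (inducedSubdivision_nonpos hspan φ)
      (h.condCone_subset (Submodule.subset_span hu))
  · rw [condGens_nonpos_iff]
    classical
    intro h T hT
    obtain ⟨hTfull, ℓ', hℓ', hTℓ⟩ := mem_inducedCells.1 hT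
    have hT' : ∀ i ∈ T, ℓ' (homog (v i)) = φ (Pi.single i 1) := hTℓ ▸ contact_apply
    have hcells : ∀ B ∈ 𝒬.cells.filter (fun B => poly v B ⊆ poly v T), B ∈ 𝒬.cells :=
      fun B hB => (Finset.mem_filter.1 hB).1
    refine ⟨fun B hB i hi => ?_, fun B hB => 𝒬.isSubdivision.fullDim B (hcells B hB), ?_,
      fun B hB B' hB' => 𝒬.isSubdivision.face B (hcells B hB) B' (hcells B' hB'),
      fun B hB B' hB' => 𝒬.isSubdivision.marking B (hcells B hB) B' (hcells B' hB')⟩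
    · obtain ⟨ℓ, hℓ, hℓB⟩ := h B (hcells B hB)
      rw [hTℓ, mem_contact]
      refine le_antisymm ?_ (hℓ' i)
      rw [← hℓB i hi]
      exact hℓ.le_of_mem_poly hT' ((Finset.mem_filter.1 hB).2 (subset_poly hi))
    · refine Set.Subset.antisymm (Set.iUnion₂_subset fun B hB => (Finset.mem_filter.1 hB).2) ?_
      set G := ⋃ B ∈ 𝒬.cells.filter (fun B => poly v B ⊆ poly v T), poly v B with hG
      have hGc : IsClosed G := isClosed_biUnion_finset fun B _ => isClosed_poly B
      refine (poly_subset_closure_interior hTfull).trans (closure_minimal (fun y hy => ?_) hGc)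
      by_contra hyG
      -- near `y` a cell `B` overlaps with the polytope of `T` in an open set, so the functional
      -- of `B` is that of `T` and `B` is one of the cells of `G`
      have hyP : y ∈ poly v Finset.univ := poly_mono T.subset_univ (interior_subset hy)
      rw [← 𝒬.isSubdivision.cover] at hyP
      obtain ⟨B, hB, hyB⟩ := Set.mem_iUnion₂.1 hyP
      have hU : IsOpen (interior (poly v T) ∩ Gᶜ) := isOpen_interior.inter hGc.isOpen_compl
      obtain ⟨z, ⟨hzT, hzG⟩, hzB⟩ := mem_closure_iff.1
        (poly_subset_closure_interior (𝒬.isSubdivision.fullDim B hB) hyB) _ hU ⟨hy, hyG⟩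
      obtain ⟨ℓ, hℓ, hℓB⟩ := h B hB
      have hagree : ∀ x ∈ interior (poly v T) ∩ interior (poly v B),
          (ℓ - ℓ') (homog x) = 0 := fun x hx => by
        rw [LinearMap.sub_apply, sub_eq_zero]
        exact le_antisymm (hℓ'.le_of_mem_poly hℓB (interior_subset hx.2))
          (hℓ.le_of_mem_poly hT' (interior_subset hx.1))
      have heq : ℓ = ℓ' := sub_eq_zero.1 (dual_eq_zero_of_affineSpan
        ((isOpen_interior.inter isOpen_interior).affineSpan_eq_top ⟨z, hzT, hzB⟩) hagree)
      have hBT : B ⊆ T := fun i hi => by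
        rw [hTℓ, mem_contact, ← heq]
        exact hℓB i hi
      exact hzG (Set.mem_iUnion₂.2 ⟨B, Finset.mem_filter.2 ⟨hB, poly_mono hBT⟩,
        interior_subset hzB⟩)

/-! ### Condition cones of induced subdivisions -/

/-- Negatives of the elements of the condition cone of `𝒬` killed by the heights `φ` lie in the
condition cone of the coarser subdivision induced by `φ`. -/
theorem neg_mem_condCone_induced (hspan : affineSpan ℝ (Set.range v) = ⊤)
    {𝒬 : Subdivision v} {φ : Module.Dual ℝ (Fin r → ℝ)}
    (h : Refines 𝒬 (inducedSubdivision hspan φ)) {u : Fin r → ℝ} (hu : u ∈ condCone 𝒬)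
    (hu0 : φ u = 0) : -u ∈ condCone (inducedSubdivision hspan φ) := by
  have hle := (refines_inducedSubdivision_iff hspan).1 h
  refine neg_mem_of_mem_hull hle (fun g hg h0 => ?_) hu hu0
  obtain ⟨B, hB, hg0, hgB⟩ := condGens_subset_relCone hg
  obtain ⟨T, hT, hBT⟩ := h.exists_superset hB
  refine relCone_subset_condCone _ hT ⟨by simp [Finset.sum_neg_distrib, hg0], fun k hk => ?_⟩
  obtain ⟨-, ℓ, hℓ, hTℓ⟩ := mem_inducedCells.1 hT
  rw [apply_eq_sum_smul_sub ℓ hg0, Finset.sum_eq_zero_iff_of_nonpos] at h0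
  · have hk0 := h0 k (Finset.mem_univ k)
    rw [smul_eq_mul, mul_eq_zero] at hk0
    rcases hk0 with hk0 | hk0
    · simp [hk0]
    · refine absurd ?_ hk
      rw [hTℓ, mem_contact]
      linarith
  · intro j _
    by_cases hj : j ∈ T
    · rw [hTℓ, mem_contact] at hj
      simp [hj]
    · exact smul_nonpos_of_nonneg_of_nonpos (hgB j fun h => hj (hBT h)) (sub_nonpos.2 (hℓ j))

/-- Conversely, the condition cone of the subdivision induced by `φ` is generated by that of `𝒬`
and the negatives of its elements killed by `φ`. -/
theorem condCone_induced_subset (hspan : affineSpan ℝ (Set.range v) = ⊤)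
    {𝒬 : Subdivision v} {φ : Module.Dual ℝ (Fin r → ℝ)}
    (h : Refines 𝒬 (inducedSubdivision hspan φ)) {D : PointedCone ℝ (Fin r → ℝ)}
    (hD : condCone 𝒬 ⊆ D) (hneg : ∀ u ∈ condCone 𝒬, φ u = 0 → -u ∈ D) :
    condCone (inducedSubdivision hspan φ) ⊆ D := by
  classical
  have : PointedCone.hull ℝ (condGens (inducedSubdivision hspan φ)) ≤ D := by
    refine Submodule.span_le.2 fun u hu => ?_
    obtain ⟨T, hT, huT⟩ := condGens_subset_relCone hu
    have hsub := h T hT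
    obtain ⟨B, hB⟩ : (𝒬.cells.filter fun B => poly v B ⊆ poly v T).Nonempty := by
      obtain ⟨y, hy⟩ := interior_poly_nonempty
        ((inducedSubdivision hspan φ).isSubdivision.fullDim T hT)
      have hy' := interior_subset hy
      rw [← hsub.cover] at hy'
      obtain ⟨B, hB, -⟩ := Set.mem_iUnion₂.1 hy'
      exact ⟨B, hB⟩
    have hBT := hsub.subset B hB
    have hBcell : B ∈ 𝒬.cells := (Finset.mem_filter.1 hB).1
    obtain ⟨Δ, hΔB, hΔ⟩ := exists_isAffBasis_subset (𝒬.isSubdivision.fullDim B hBcell)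
    have hmem : ∀ i a, homog (v i) = ∑ w ∈ Δ, a w • homog (v w) →
        relVec i Δ a ∈ condCone 𝒬 := fun i a ha =>
      Submodule.subset_span ⟨B, hBcell, Δ, hΔB, hΔ, i, a, ha, Or.inl rfl⟩
    refine relCone_subset_of_relVec_mem hΔ D (fun i a ha => hD (hmem i a ha))
      (fun i hi a ha => hneg _ (hmem i a ha) ?_) huT
    obtain ⟨-, ℓ, hℓ, hTℓ⟩ := mem_inducedCells.1 hT
    have hT0 : ∀ k ∈ T, φ (Pi.single k 1) - ℓ (homog (v k)) = 0 := fun k hk => by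
      rw [hTℓ, mem_contact] at hk
      rw [hk, sub_self]
    rw [apply_eq_sum_smul_sub ℓ (by rw [sum_relVec_smul, ha, sub_self]), sum_relVec_smul,
      hT0 i hi, Finset.sum_eq_zero fun w hw => ?_, sub_zero]
    rw [hT0 w (hBT (hΔB hw)), smul_zero]
  exact this

theorem condCone_add_line_eq_hull (𝒬 : Subdivision v) (u : Fin r → ℝ) :
    {x | ∃ c ∈ condCone 𝒬, ∃ t : ℝ, x = c + t • u} =
      (PointedCone.hull ℝ (condGens 𝒬 ∪ {u, -u}) : Set (Fin r → ℝ)) := by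
  have hsup : PointedCone.hull ℝ (condGens 𝒬 ∪ {u, -u}) =
      PointedCone.hull ℝ (condGens 𝒬) ⊔ PointedCone.hull ℝ {u, -u} := Submodule.span_union _ _
  ext x
  rw [SetLike.mem_coe, hsup, Submodule.mem_sup]
  constructor
  · rintro ⟨c, hc, t, rfl⟩
    refine ⟨c, hc, t • u, ?_, rfl⟩
    rcases le_total 0 t with ht | ht
    · exact PointedCone.smul_mem _ ht (Submodule.subset_span (by simp))
    · rw [← neg_smul_neg]
      exact PointedCone.smul_mem _ (neg_nonneg.2 ht) (Submodule.subset_span (by simp))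
  · rintro ⟨c, hc, y, hy, rfl⟩
    obtain ⟨a, b, rfl⟩ := Submodule.mem_span_pair.1 hy
    refine ⟨c, hc, (a : ℝ) - b, ?_⟩
    rw [sub_smul, smul_neg, sub_eq_add_neg]
    rfl

theorem isCoface_condCone_induced (hspan : affineSpan ℝ (Set.range v) = ⊤)
    {𝒬 : Subdivision v} {φ : Module.Dual ℝ (Fin r → ℝ)}
    (h : Refines 𝒬 (inducedSubdivision hspan φ)) :
    IsCoface (condCone (inducedSubdivision hspan φ)) (condCone 𝒬) := by
  classical
  have hle := (refines_inducedSubdivision_iff hspan).1 h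
  -- the sum of all generators killed by `φ` lies in the relative interior of the face of the
  -- condition cone on which `φ` vanishes
  set Z := (condGens_finite 𝒬).toFinset.filter fun g => φ g = 0 with hZ
  have hZmem : ∀ g ∈ Z, g ∈ condGens 𝒬 ∧ φ g = 0 := fun g hg => by
    simpa [hZ] using hg
  set u := ∑ g ∈ Z, g with hu
  have huC : u ∈ condCone 𝒬 := Submodule.sum_mem _ fun g hg =>
    Submodule.subset_span (hZmem g hg).1
  have hu0 : φ u = 0 := by
    rw [hu, map_sum]
    exact Finset.sum_eq_zero fun g hg => (hZmem g hg).2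
  refine ⟨u, huC, Set.Subset.antisymm ?_ ?_⟩
  · rw [condCone_add_line_eq_hull]
    refine condCone_induced_subset hspan h (Submodule.span_mono Set.subset_union_left) ?_
    refine fun c hc hc0 => neg_mem_of_mem_hull hle (fun g hg h0 => ?_) hc hc0
    -- `-g = -u + ∑ g'` over the other generators `g'` killed by `φ`
    have hgZ : g ∈ Z := Finset.mem_filter.2 ⟨(condGens_finite 𝒬).mem_toFinset.2 hg, h0⟩
    have : -g = -u + ∑ g' ∈ Z.erase g, g' := by
      rw [hu, ← Finset.add_sum_erase Z _ hgZ]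
      abel
    rw [this]
    exact add_mem (Submodule.subset_span (by simp)) (Submodule.sum_mem _ fun g' hg' =>
      Submodule.subset_span (Or.inl (hZmem g' (Finset.mem_of_mem_erase hg')).1))
  · rw [condCone_add_line_eq_hull]
    refine Submodule.span_le.2 (Set.union_subset
      (Submodule.subset_span.trans h.condCone_subset) ?_)
    rintro _ (rfl | rfl)
    · exact h.condCone_subset huC
    · exact neg_mem_condCone_induced hspan h huC hu0

/-! ### Regular subdivisions -/

theorem refines_of_condCone_subset (hspan : affineSpan ℝ (Set.range v) = ⊤) {𝒬 : Subdivision v}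
    {φ : Module.Dual ℝ (Fin r → ℝ)} (h : condCone 𝒬 ⊆ condCone (inducedSubdivision hspan φ)) :
    Refines 𝒬 (inducedSubdivision hspan φ) :=
  (refines_inducedSubdivision_iff hspan).2 fun _ hu =>
    dual_nonpos_of_mem_hull (inducedSubdivision_nonpos hspan φ) (h (Submodule.subset_span hu))

theorem isRegular_inducedSubdivision (hspan : affineSpan ℝ (Set.range v) = ⊤)
    (φ : Module.Dual ℝ (Fin r → ℝ)) : IsRegular (inducedSubdivision hspan φ) :=
  fun _ h hne => ⟨h.condCone_subset, fun hsub =>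
    hne ((refines_of_condCone_subset hspan hsub).antisymm h)⟩

/-- For `φ` in the relative interior of the polar of a finitely generated cone, the condition cone
of the subdivision induced by `φ` stays inside this cone, provided that the cone contains the
generators of some condition cone. -/
theorem exists_refines_condCone_subset (hspan : affineSpan ℝ (Set.range v) = ⊤)
    {s : Set (Fin r → ℝ)} (hs : s.Finite) :
    ∃ φ : Module.Dual ℝ (Fin r → ℝ), (∀ u ∈ s, φ u ≤ 0) ∧ ∀ 𝒬 : Subdivision v,
      condGens 𝒬 ⊆ s → Refines 𝒬 (inducedSubdivision hspan φ) ∧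
        condCone (inducedSubdivision hspan φ) ⊆ (PointedCone.hull ℝ s : Set (Fin r → ℝ)) := by
  obtain ⟨φ, hφ, hneg⟩ := exists_dual_strict hs
  refine ⟨φ, hφ, fun 𝒬 h𝒬 => ?_⟩
  have hle : condCone 𝒬 ⊆ (PointedCone.hull ℝ s : Set (Fin r → ℝ)) := Submodule.span_mono h𝒬
  have href : Refines 𝒬 (inducedSubdivision hspan φ) :=
    (refines_inducedSubdivision_iff hspan).2 fun u hu => hφ u (h𝒬 hu)
  exact ⟨href, condCone_induced_subset hspan href hle fun u hu => hneg u (hle hu)⟩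

/-- Regular subdivisions are those induced by heights. -/
theorem IsRegular.exists_eq_induced (hspan : affineSpan ℝ (Set.range v) = ⊤) {𝒬 : Subdivision v}
    (h : IsRegular 𝒬) : ∃ φ : Module.Dual ℝ (Fin r → ℝ), 𝒬 = inducedSubdivision hspan φ := by
  obtain ⟨φ, -, hφ⟩ := exists_refines_condCone_subset hspan (condGens_finite 𝒬)
  obtain ⟨href, hsub⟩ := hφ 𝒬 subset_rfl
  refine ⟨φ, ?_⟩
  by_contra hne
  exact (h _ href (Ne.symm hne)).2 hsub

theorem exists_condCone_eq_coface (hspan : affineSpan ℝ (Set.range v) = ⊤) (𝒬 : Subdivision v)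
    {F : Set (Fin r → ℝ)} (hF : IsCoface F (condCone 𝒬)) :
    ∃ 𝒬' : Subdivision v, IsRegular 𝒬' ∧ Refines 𝒬 𝒬' ∧ F = condCone 𝒬' := by
  obtain ⟨u, hu, rfl⟩ := hF
  obtain ⟨φ, hφ, h⟩ := exists_refines_condCone_subset hspan
    ((condGens_finite 𝒬).union (Set.toFinite {u, -u}))
  obtain ⟨href, hsub⟩ := h 𝒬 Set.subset_union_left
  refine ⟨_, isRegular_inducedSubdivision hspan φ, href, ?_⟩
  rw [condCone_add_line_eq_hull]
  refine Set.Subset.antisymm (Submodule.span_le.2 (Set.union_subset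
    (Submodule.subset_span.trans href.condCone_subset) ?_)) hsub
  have hu0 : φ u = 0 := by
    have h1 := hφ u (by simp)
    have h2 := hφ (-u) (by simp)
    rw [map_neg] at h2
    linarith
  rintro _ (rfl | rfl)
  · exact href.condCone_subset hu
  · exact neg_mem_condCone_induced hspan href hu hu0

theorem isCoface_condCone_add (hspan : affineSpan ℝ (Set.range v) = ⊤) (𝒬₁ 𝒬₂ : Subdivision v) :
    IsCoface (condCone 𝒬₁ + condCone 𝒬₂) (condCone 𝒬₁) ∧
      IsCoface (condCone 𝒬₁ + condCone 𝒬₂) (condCone 𝒬₂) := by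
  obtain ⟨φ, -, h⟩ := exists_refines_condCone_subset hspan
    ((condGens_finite 𝒬₁).union (condGens_finite 𝒬₂))
  obtain ⟨h₁, hsub⟩ := h 𝒬₁ Set.subset_union_left
  obtain ⟨h₂, -⟩ := h 𝒬₂ Set.subset_union_right
  have hadd : condCone 𝒬₁ + condCone 𝒬₂ = condCone (inducedSubdivision hspan φ) := by
    refine Set.Subset.antisymm ?_ ?_
    · rintro _ ⟨x, hx, y, hy, rfl⟩
      exact add_mem (S := PointedCone ℝ (Fin r → ℝ)) (h₁.condCone_subset hx)
        (h₂.condCone_subset hy)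
    · have hsup : PointedCone.hull ℝ (condGens 𝒬₁ ∪ condGens 𝒬₂) =
          PointedCone.hull ℝ (condGens 𝒬₁) ⊔ PointedCone.hull ℝ (condGens 𝒬₂) :=
        Submodule.span_union _ _
      rwa [hsup, Submodule.coe_sup] at hsub
  rw [hadd]
  exact ⟨isCoface_condCone_induced hspan h₁, isCoface_condCone_induced hspan h₂⟩

theorem finite_subdivision (v : Fin r → (Fin d → ℝ)) : Finite (Subdivision v) :=
  Finite.of_injective Subdivision.cells fun _ _ => Subdivision.ext

/-! ### The fan and the co-fan -/

theorem zero_mem_condCone (𝒬 : Subdivision v) : 0 ∈ condCone 𝒬 := Submodule.zero_mem _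

theorem copolar_closedCone (hN : 1 ≤ N) (hspan : affineSpan ℝ (Set.range v) = ⊤)
    (𝒬 : Subdivision v) : copolar (closedCone 𝒬 N) = condCone 𝒬 := by
  rw [closedCone_eq_polar hspan, copolar_polar hN (isPolyhedralCone_condCone 𝒬)]

theorem isFace_closedCone_iff (hN : 1 ≤ N) (hspan : affineSpan ℝ (Set.range v) = ⊤)
    (𝒬 : Subdivision v) (F : Set (Matrix (Fin N) (Fin r) ℝ)) :
    IsFace F (closedCone 𝒬 N) ↔
      ∃ 𝒬' : Subdivision v, IsRegular 𝒬' ∧ Refines 𝒬 𝒬' ∧ F = closedCone 𝒬' N := by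
  rw [closedCone_eq_polar hspan, isFace_polar_iff hN (isPolyhedralCone_condCone 𝒬)]
  constructor
  · rintro ⟨D, hD, rfl⟩
    obtain ⟨𝒬', hreg, href, rfl⟩ := exists_condCone_eq_coface hspan 𝒬 hD
    exact ⟨𝒬', hreg, href, (closedCone_eq_polar hspan 𝒬').symm⟩
  · rintro ⟨𝒬', hreg, href, rfl⟩
    obtain ⟨φ, rfl⟩ := hreg.exists_eq_induced hspan
    exact ⟨_, isCoface_condCone_induced hspan href, closedCone_eq_polar hspan _⟩

theorem isFan_gkzFan (hN : 1 ≤ N) (hspan : affineSpan ℝ (Set.range v) = ⊤) :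
    IsFan (gkzFan v N) where
  finite := by
    have := finite_subdivision v
    refine (Set.finite_range fun 𝒬 : Subdivision v => closedCone 𝒬 N).subset ?_
    rintro _ ⟨𝒬, -, rfl⟩
    exact ⟨𝒬, rfl⟩
  muPolyhedral := by
    rintro _ ⟨𝒬, -, rfl⟩
    rw [closedCone_eq_polar hspan]
    exact isMuPolyhedralCone_polar (isPolyhedralCone_condCone 𝒬)
  face_mem := by
    rintro _ ⟨𝒬, -, rfl⟩ F hF
    obtain ⟨𝒬', hreg, -, rfl⟩ := (isFace_closedCone_iff hN hspan 𝒬 F).1 hF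
    exact ⟨𝒬', hreg, rfl⟩
  inter_face := by
    rintro _ ⟨𝒬₁, -, rfl⟩ _ ⟨𝒬₂, -, rfl⟩
    obtain ⟨h₁, h₂⟩ := isCoface_condCone_add hspan 𝒬₁ 𝒬₂
    rw [closedCone_eq_polar hspan, closedCone_eq_polar hspan,
      ← polar_add (zero_mem_condCone 𝒬₁) (zero_mem_condCone 𝒬₂)]
    exact ⟨(isFace_polar_iff hN (isPolyhedralCone_condCone 𝒬₁)).2 ⟨_, h₁, rfl⟩,
      (isFace_polar_iff hN (isPolyhedralCone_condCone 𝒬₂)).2 ⟨_, h₂, rfl⟩⟩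

theorem isCofan_gkzCofan (hspan : affineSpan ℝ (Set.range v) = ⊤) : IsCofan (gkzCofan v) where
  finite := by
    have := finite_subdivision v
    refine (Set.finite_range fun 𝒬 : Subdivision v => condCone 𝒬).subset ?_
    rintro _ ⟨𝒬, -, rfl⟩
    exact ⟨𝒬, rfl⟩
  polyhedral := by
    rintro _ ⟨𝒬, -, rfl⟩
    exact isPolyhedralCone_condCone 𝒬
  coface_mem := by
    rintro _ ⟨𝒬, -, rfl⟩ F hF
    obtain ⟨𝒬', hreg, -, rfl⟩ := exists_condCone_eq_coface hspan 𝒬 hF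
    exact ⟨𝒬', hreg, rfl⟩
  add_coface := by
    rintro _ ⟨𝒬₁, -, rfl⟩ _ ⟨𝒬₂, -, rfl⟩
    exact isCoface_condCone_add hspan 𝒬₁ 𝒬₂

theorem polarCorrespondence_gkz (hN : 1 ≤ N) (hspan : affineSpan ℝ (Set.range v) = ⊤) :
    PolarCorrespondence (gkzFan v N) (gkzCofan v) := by
  have hinv : Set.InvOn copolar (polar N) (gkzCofan v) (gkzFan v N) := by
    constructor
    · rintro _ ⟨𝒬, -, rfl⟩
      exact copolar_polar hN (isPolyhedralCone_condCone 𝒬)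
    · rintro _ ⟨𝒬, -, rfl⟩
      rw [copolar_closedCone hN hspan, closedCone_eq_polar hspan]
  have hmaps : Set.MapsTo (polar N) (gkzCofan v) (gkzFan v N) := by
    rintro _ ⟨𝒬, hreg, rfl⟩
    exact ⟨𝒬, hreg, (closedCone_eq_polar hspan 𝒬).symm⟩
  have hmaps' : Set.MapsTo copolar (gkzFan v N) (gkzCofan v) := by
    rintro _ ⟨𝒬, hreg, rfl⟩
    exact ⟨𝒬, hreg, copolar_closedCone hN hspan 𝒬⟩
  exact ⟨hinv.bijOn hmaps hmaps', hinv.symm.bijOn hmaps' hmaps, hinv⟩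

theorem IsRegular.eq_of_condCone_eq (hspan : affineSpan ℝ (Set.range v) = ⊤)
    {𝒬 𝒬' : Subdivision v} (h : IsRegular 𝒬) (h' : IsRegular 𝒬')
    (heq : condCone 𝒬 = condCone 𝒬') : 𝒬 = 𝒬' := by
  obtain ⟨φ, rfl⟩ := h.exists_eq_induced hspan
  obtain ⟨φ', rfl⟩ := h'.exists_eq_induced hspan
  exact (refines_of_condCone_subset hspan heq.le).antisymm
    (refines_of_condCone_subset hspan heq.ge)

theorem isComplete_gkzFan (hspan : affineSpan ℝ (Set.range v) = ⊤) :
    IsComplete (gkzFan v N) := by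
  refine Set.eq_univ_of_forall fun Ψ => ?_
  have := finite_subdivision v
  obtain ⟨φ, hφ⟩ := exists_dual_lexMap_nonpos Ψ
    (Set.finite_iUnion fun 𝒬 : Subdivision v => condGens_finite 𝒬)
  refine ⟨_, ⟨inducedSubdivision hspan φ, isRegular_inducedSubdivision hspan φ, rfl⟩, ?_⟩
  rw [closedCone_eq_polar hspan, condCone, mem_polar_hull_iff]
  exact fun u hu => hφ u (Set.mem_iUnion.2 ⟨_, hu⟩) (inducedSubdivision_nonpos hspan φ u hu)

end GKZ

theorem mainTheorem4 (d r N : ℕ) (hN : 1 ≤ N) (v : Fin r → (Fin d → ℝ))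
    (hv : Function.Injective v) (hspan : affineSpan ℝ (Set.range v) = ⊤) :
    -- the fan and the co-fan, in polar correspondence, cone by cone
    GKZ.IsFan (GKZ.gkzFan v N) ∧
    GKZ.IsCofan (GKZ.gkzCofan v) ∧
    GKZ.PolarCorrespondence (GKZ.gkzFan v N) (GKZ.gkzCofan v) ∧
    (∀ 𝒬 : GKZ.Subdivision v, GKZ.IsRegular 𝒬 →
      GKZ.closedCone 𝒬 N = GKZ.polar N (GKZ.condCone 𝒬) ∧
      GKZ.condCone 𝒬 = GKZ.copolar (GKZ.closedCone 𝒬 N)) ∧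
    -- the cones are pairwise different
    (∀ 𝒬 𝒬' : GKZ.Subdivision v, GKZ.IsRegular 𝒬 → GKZ.IsRegular 𝒬' → 𝒬 ≠ 𝒬' →
      GKZ.closedCone 𝒬 N ≠ GKZ.closedCone 𝒬' N) ∧
    -- description of the faces
    (∀ 𝒬 : GKZ.Subdivision v, GKZ.IsRegular 𝒬 → ∀ F : Set (Matrix (Fin N) (Fin r) ℝ),
      GKZ.IsFace F (GKZ.closedCone 𝒬 N) ↔
        ∃ 𝒬' : GKZ.Subdivision v, GKZ.IsRegular 𝒬' ∧ GKZ.Refines 𝒬 𝒬' ∧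
          F = GKZ.closedCone 𝒬' N) ∧
    -- completeness
    GKZ.IsComplete (GKZ.gkzFan v N) := by
  exact ⟨GKZ.isFan_gkzFan hN hspan, GKZ.isCofan_gkzCofan hspan,
    GKZ.polarCorrespondence_gkz hN hspan,
    fun 𝒬 _ => ⟨GKZ.closedCone_eq_polar hspan 𝒬, (GKZ.copolar_closedCone hN hspan 𝒬).symm⟩,
    fun 𝒬 𝒬' h h' hne heq => hne (h.eq_of_condCone_eq hspan h' (by
      rw [← GKZ.copolar_closedCone hN hspan 𝒬, heq, GKZ.copolar_closedCone hN hspan 𝒬'])),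
    fun 𝒬 _ F => GKZ.isFace_closedCone_iff hN hspan 𝒬 F,
    GKZ.isComplete_gkzFan hspan⟩
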